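/- Let $\mathbb G$ be a stratified Lie group of homogeneous dimension $Q\ge 3$, that is (in coordinates) $\mathbb G=(\mathbb R^n,\circ,\delta_r)$ with a Lie group law $\circ$ with neutral element $0$, dilations $\delta_r(x)=(r^{\sigma_1}x_1,\dots,r^{\sigma_n}x_n)$, $r>0$, with positive integer weights $\sigma_i$, that are automorphisms, and such that the left-invariant vector fields $X_k$ with $X_k(0)=\partial/\partial x_k$ and $\sigma_k=1$ generate a Lie algebra of rank $n$ at every point; $Q=\sum_i\sigma_i$. Write $\nabla_{\mathbb G}=(X_k)_{\sigma_k=1}$, $\Delta_{\mathbb G}=\sum_{\sigma_k=1}X_k^2$, $\nabla_{\mathbb G}(a\nabla_{\mathbb G}\psi)=\sum_{\sigma_k=1}X_k(aX_k\psi)$, and let $dx$ be Lebesgue measure. Let $d$ be a $\Delta_{\mathbb G}$-gauge: a continuous function $d:\mathbb G\to[0,\infty)$ that vanishes exactly at $0$, satisfies $d(\delta_r x)=r\,d(x)$ for $r>0$ and $d(x^{-1})=d(x)$, is $C^\infty$ on $\mathbb G\setminus\{0\}$, and satisfies $\Delta_{\mathbb G}(d^{2-Q})=0$ on $\mathbb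 G\setminus\{0\}$. Let $0<\lambda\le\left(\frac{Q-2}{2}\right)^2$, $\alpha=\frac{Q-2}{2}-\sqrt{\left(\frac{Q-2}{2}\right)^2-\lambda}$, and $p>1$. Let $f,u_0:\mathbb G\to\mathbb R$ with $d^{-\alpha}f\in L^1(\mathbb G)$. Test functions are the non-negative $\psi\in C^1_c([0,\infty);C^2_c(\mathbb G))$. (i) A global-in-time weak solution of $$d^{-2\alpha}w_t-\nabla_{\mathbb G}(d^{-2\alpha}\nabla_{\mathbb G}w)=d^{-\alpha(p+1)}w^p+d^{-\alpha}f\ \text{ on }(0,\infty)\times\mathbb G,\qquad w(0,\cdot)=d^{\alpha}u_0,\qquad(1)$$ is a function $w\ge0$ (a.e.) such that $d^{-2\alpha}w$ and $d^{-\alpha(p+1)}w^p$ belong to $L^1_{loc}((0,\infty)\times\mathbb G)$, $d^{-2\alpha}w(0,\cdot)=d^{-\alpha}u_0\in L^1_{loc}(\mathbb G)$, and $$\int_0^\infty\!\!\int_{\mathbb G}\big(d^{-\alpha(p+1)}w^p+d^{-\alpha}f\big)\psi\,dx\,dt+\int_{\mathbb G}d^{-2\alpha}w(0,x)\psi(0,x)\,dx+\int_0^\infty\!\!\int_{\mathbb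 G}d^{-2\alpha}w\,\psi_t\,dx\,dt+\int_0^\infty\!\!\int_{\mathbb G}w\,\nabla_{\mathbb G}(d^{-2\alpha}\nabla_{\mathbb G}\psi)\,dx\,dt=0$$ for every test function $\psi$ for which these integrals converge absolutely. (ii) A global-in-time weak solution of $$u_t-\Delta_{\mathbb G}u-\lambda\frac{|\nabla_{\mathbb G}d|^2}{d^2}u=u^p+f\ \text{ on }(0,\infty)\times\mathbb G,\qquad u(0,\cdot)=u_0,\qquad(2)$$ is a function $u\ge0$ (a.e.) such that $d^{-\alpha}u$ and $d^{-\alpha}u^p$ belong to $L^1_{loc}((0,\infty)\times\mathbb G)$, $d^{-\alpha}u_0\in L^1_{loc}(\mathbb G)$, and $$\int_0^\infty\!\!\int_{\mathbb G}(u^p+f)\varphi\,dx\,dt+\int_{\mathbb G}u_0\varphi(0,x)\,dx+\int_0^\infty\!\!\int_{\mathbb G}u\,\varphi_t\,dx\,dt+\int_0^\infty\!\!\int_{\mathbb G}u\Big(\Delta_{\mathbb G}\varphi+\lambda\frac{|\nabla_{\mathbb G}d|^2}{d^2}\varphi\Big)dx\,dt=0$$ for every $\varphi=d^{-\alpha}\psi$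 with $\psi$ a test function for which these integrals converge absolutely. Theorem. If $p<\frac{Q-\alpha}{Q-2-\alpha}$, $u_0\ge0$ a.e. and $\int_{\mathbb G}d^{-\alpha}f\,dx>0$, then neither (1) nor (2) has a global-in-time weak solution. -/

import Mathlib

open MeasureTheory Set
open scoped ContDiff

noncomputable section

/-- The vector field `x ↦ d/ds|_{s=0} (x ∘ s e_k)`: when `mul` is a Lie group law on `ℝⁿ` with
neutral element `0`, it is the left-invariant vector field that equals `∂/∂x_k` at the origin. -/
def leftField {n : ℕ} (mul : (Fin n → ℝ) → (Fin n → ℝ) → (Fin n → ℝ)) (k : Fin n)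
    (x : Fin n → ℝ) : Fin n → ℝ :=
  fderiv ℝ (mul x) 0 (Pi.single k 1)

/-- The iterated Lie brackets of a family `S` of vector fields on `ℝⁿ`. Their linear span is the
Lie algebra generated by `S`. -/
inductive IsIteratedBracket {n : ℕ} (S : Set ((Fin n → ℝ) → (Fin n → ℝ))) :
    ((Fin n → ℝ) → (Fin n → ℝ)) → Prop
  | base (V : (Fin n → ℝ) → (Fin n → ℝ)) (hV : V ∈ S) : IsIteratedBracket S V
  | bracket (V W : (Fin n → ℝ) → (Fin n → ℝ)) (hV : IsIteratedBracket S V)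
      (hW : IsIteratedBracket S W) : IsIteratedBracket S (VectorField.lieBracket ℝ V W)

/-- A stratified Lie group (homogeneous Carnot group) `𝔾 = (ℝⁿ, ∘, δ_r)`: a Lie group law on `ℝⁿ`
with neutral element `0` for which the dilations `δ_r (x) = (r ^ σ₁ x₁, …, r ^ σₙ xₙ)`, with
positive integer weights `σ_i`, are automorphisms, and such that the left-invariant vector fields
`X_k` with `X_k (0) = ∂/∂x_k` and `σ_k = 1` generate a Lie algebra of rank `n` at every point. -/
structure StratifiedLieGroup (n : ℕ) where
  /-- the group law `x ∘ y` -/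
  mul : (Fin n → ℝ) → (Fin n → ℝ) → (Fin n → ℝ)
  /-- the group inverse -/
  inv : (Fin n → ℝ) → (Fin n → ℝ)
  /-- the weights of the coordinates: the `j`-th layer is spanned by those of weight `j` -/
  weight : Fin n → ℕ
  mul_assoc : ∀ x y z, mul (mul x y) z = mul x (mul y z)
  zero_mul : ∀ x, mul 0 x = x
  mul_zero : ∀ x, mul x 0 = x
  inv_mul : ∀ x, mul (inv x) x = 0
  contDiff_mul : ContDiff ℝ ∞ (fun z : (Fin n → ℝ) × (Fin n → ℝ) => mul z.1 z.2)
  contDiff_inv : ContDiff ℝ ∞ inv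
  weight_pos : ∀ i, 1 ≤ weight i
  dilation_mul : ∀ r : ℝ, 0 < r → ∀ x y : Fin n → ℝ,
    (fun i => r ^ weight i * mul x y i) =
      mul (fun i => r ^ weight i * x i) (fun i => r ^ weight i * y i)
  rank_generated : ∀ x : Fin n → ℝ,
    Submodule.span ℝ {v : Fin n → ℝ | ∃ V : (Fin n → ℝ) → (Fin n → ℝ),
      IsIteratedBracket {Y | ∃ k, weight k = 1 ∧ Y = leftField mul k} V ∧ v = V x} = ⊤

namespace StratifiedLieGroup

variable {n : ℕ} (G : StratifiedLieGroup n)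

/-- The dilation `δ_r`. -/
def dilation (r : ℝ) (x : Fin n → ℝ) : Fin n → ℝ := fun i => r ^ G.weight i * x i

/-- The homogeneous dimension `Q = ∑_j j · dim (j-th layer)`. -/
def homDim : ℕ := ∑ i, G.weight i

/-- The indices `k` of the horizontal vector fields `X_k` (the first layer). -/
def horizontal : Finset (Fin n) := Finset.univ.filter (fun k => G.weight k = 1)

/-- The derivative `X_k u` of a function along the left-invariant vector field `X_k`. -/
def X (k : Fin n) (u : (Fin n → ℝ) → ℝ) (x : Fin n → ℝ) : ℝ :=
  fderiv ℝ u x (leftField G.mul k x)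

/-- The sub-Laplacian `Δ_𝔾 u = ∑ X_k² u`, the sum over the first layer. -/
def subLaplacian (u : (Fin n → ℝ) → ℝ) (x : Fin n → ℝ) : ℝ :=
  ∑ k ∈ G.horizontal, G.X k (G.X k u) x

/-- The squared length `|∇_𝔾 u|²` of the horizontal gradient. -/
def gradSq (u : (Fin n → ℝ) → ℝ) (x : Fin n → ℝ) : ℝ :=
  ∑ k ∈ G.horizontal, G.X k u x ^ 2

/-- The operator `∇_𝔾 · (a ∇_𝔾 u) = ∑ X_k (a X_k u)` with scalar coefficient `a`. -/
def divGrad (a u : (Fin n → ℝ) → ℝ) (x : Fin n → ℝ) : ℝ :=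
  ∑ k ∈ G.horizontal, G.X k (fun y => a y * G.X k u y) x

/-- `d` is a `Δ_𝔾`-gauge: a symmetric homogeneous norm that is smooth away from the origin and for
which `Δ_𝔾 (d ^ (2 - Q)) = 0` away from the origin. -/
structure IsGauge (d : (Fin n → ℝ) → ℝ) : Prop where
  continuous : Continuous d
  zero : d 0 = 0
  pos : ∀ x, x ≠ 0 → 0 < d x
  dilation : ∀ r : ℝ, 0 < r → ∀ x, d (G.dilation r x) = r * d x
  symm : ∀ x, d (G.inv x) = d x
  smooth : ContDiffOn ℝ ∞ d {0}ᶜ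
  harmonic : ∀ x, x ≠ 0 → G.subLaplacian (fun y => d y ^ (2 - (G.homDim : ℝ))) x = 0

/-- The smaller root `α = (Q-2)/2 - √(((Q-2)/2)² - λ)` of `α² - (Q-2) α + λ`. -/
def hardyExponent (lam : ℝ) : ℝ :=
  ((G.homDim : ℝ) - 2) / 2 - Real.sqrt ((((G.homDim : ℝ) - 2) / 2) ^ 2 - lam)

end StratifiedLieGroup

/-- The non-negative test functions `ψ ∈ C¹_c([0,∞); C²_c(ℝⁿ))`, presented as restrictions to
`t ≥ 0` of functions in `C¹_c(ℝ; C²_c(ℝⁿ))` (every `C¹` function on `[0,∞)` extends across `t = 0`):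
`ψ` has compact support, `ψ` and `∂_t ψ` are `C²` in space, and their spatial derivatives up to
order two are jointly continuous in `(t, x)`. The support may contain points with `t = 0`. -/
structure IsTestFunction {n : ℕ} (ψ : ℝ → (Fin n → ℝ) → ℝ) : Prop where
  compact_support : HasCompactSupport (fun z : ℝ × (Fin n → ℝ) => ψ z.1 z.2)
  nonneg : ∀ t, 0 ≤ t → ∀ x, 0 ≤ ψ t x
  space : ∀ t, ContDiff ℝ 2 (ψ t)
  space_cont : ∀ k : ℕ, k ≤ 2 →
    Continuous (fun z : ℝ × (Fin n → ℝ) => iteratedFDeriv ℝ k (ψ z.1) z.2)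
  time : ∀ x, Differentiable ℝ (fun t => ψ t x)
  time_space : ∀ t, ContDiff ℝ 2 (fun x => deriv (fun s => ψ s x) t)
  time_space_cont : ∀ k : ℕ, k ≤ 2 →
    Continuous (fun z : ℝ × (Fin n → ℝ) =>
      iteratedFDeriv ℝ k (fun x => deriv (fun s => ψ s x) z.1) z.2)

/-- The space-time domain `(0,∞) × 𝔾`. -/
def spaceTime (n : ℕ) : Set (ℝ × (Fin n → ℝ)) := Ioi (0 : ℝ) ×ˢ univ

/-- `w ≥ 0` is a global-in-time weak solution of
`d^{-2α} w_t - ∇_𝔾 · (d^{-2α} ∇_𝔾 w) = d^{-α(p+1)} w^p + d^{-α} f` on `(0,∞) × 𝔾`, `w(0,·) = w₀`.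
The weak equation is asked for every test function for which its integrals converge absolutely;
hence a function that makes all of these integrals converge and satisfies the equation for every
test function is in particular a solution in this sense. -/
structure IsGlobalWeakSolution {n : ℕ} (G : StratifiedLieGroup n) (d : (Fin n → ℝ) → ℝ)
    (α p : ℝ) (f w₀ : (Fin n → ℝ) → ℝ) (w : ℝ → (Fin n → ℝ) → ℝ) : Prop where
  nonneg : ∀ᵐ z ∂(volume.restrict (spaceTime n)), 0 ≤ w z.1 z.2
  initial : LocallyIntegrable (fun x => d x ^ (-2 * α) * w₀ x) volume
  locL1 : LocallyIntegrableOn (fun z : ℝ × (Fin n → ℝ) => d z.2 ^ (-2 * α) * w z.1 z.2)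
    (spaceTime n) volume
  locLp : LocallyIntegrableOn
    (fun z : ℝ × (Fin n → ℝ) => d z.2 ^ (-α * (p + 1)) * w z.1 z.2 ^ p) (spaceTime n) volume
  weak : ∀ ψ : ℝ → (Fin n → ℝ) → ℝ, IsTestFunction ψ →
    IntegrableOn (fun z : ℝ × (Fin n → ℝ) =>
      (d z.2 ^ (-α * (p + 1)) * w z.1 z.2 ^ p + d z.2 ^ (-α) * f z.2) * ψ z.1 z.2)
      (spaceTime n) volume →
    IntegrableOn (fun z : ℝ × (Fin n → ℝ) =>
      d z.2 ^ (-2 * α) * w z.1 z.2 * deriv (fun s => ψ s z.2) z.1) (spaceTime n) volume →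
    IntegrableOn (fun z : ℝ × (Fin n → ℝ) =>
      w z.1 z.2 * G.divGrad (fun y => d y ^ (-2 * α)) (ψ z.1) z.2) (spaceTime n) volume →
    (∫ z in spaceTime n,
        (d z.2 ^ (-α * (p + 1)) * w z.1 z.2 ^ p + d z.2 ^ (-α) * f z.2) * ψ z.1 z.2)
      + (∫ x, d x ^ (-2 * α) * w₀ x * ψ 0 x)
      + (∫ z in spaceTime n, d z.2 ^ (-2 * α) * w z.1 z.2 * deriv (fun s => ψ s z.2) z.1)
      + (∫ z in spaceTime n, w z.1 z.2 * G.divGrad (fun y => d y ^ (-2 * α)) (ψ z.1) z.2) = 0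

/-- `u ≥ 0` is a global-in-time weak solution of the problem with Hardy potential
`u_t - Δ_𝔾 u - λ |∇_𝔾 d|² u / d² = u^p + f` on `(0,∞) × 𝔾`, `u(0,·) = u₀`: the equation is tested
against the functions `d^{-α} ψ` with `ψ` a test function, with the same convention on absolute
convergence as for the transformed problem. -/
structure IsGlobalWeakSolutionHardy {n : ℕ} (G : StratifiedLieGroup n) (d : (Fin n → ℝ) → ℝ)
    (lam p : ℝ) (f u₀ : (Fin n → ℝ) → ℝ) (u : ℝ → (Fin n → ℝ) → ℝ) : Prop where
  nonneg : ∀ᵐ z ∂(volume.restrict (spaceTime n)), 0 ≤ u z.1 z.2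
  initial : LocallyIntegrable (fun x => d x ^ (-G.hardyExponent lam) * u₀ x) volume
  locL1 : LocallyIntegrableOn
    (fun z : ℝ × (Fin n → ℝ) => d z.2 ^ (-G.hardyExponent lam) * u z.1 z.2) (spaceTime n) volume
  locLp : LocallyIntegrableOn
    (fun z : ℝ × (Fin n → ℝ) => d z.2 ^ (-G.hardyExponent lam) * u z.1 z.2 ^ p)
    (spaceTime n) volume
  weak : ∀ ψ φ : ℝ → (Fin n → ℝ) → ℝ, IsTestFunction ψ →
    (∀ t x, φ t x = d x ^ (-G.hardyExponent lam) * ψ t x) →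
    IntegrableOn (fun z : ℝ × (Fin n → ℝ) => (u z.1 z.2 ^ p + f z.2) * φ z.1 z.2)
      (spaceTime n) volume →
    IntegrableOn (fun z : ℝ × (Fin n → ℝ) => u z.1 z.2 * deriv (fun s => φ s z.2) z.1)
      (spaceTime n) volume →
    IntegrableOn (fun z : ℝ × (Fin n → ℝ) =>
      u z.1 z.2 * (G.subLaplacian (φ z.1) z.2
        + lam * G.gradSq d z.2 / d z.2 ^ 2 * φ z.1 z.2)) (spaceTime n) volume →
    (∫ z in spaceTime n, (u z.1 z.2 ^ p + f z.2) * φ z.1 z.2)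
      + (∫ x, u₀ x * φ 0 x)
      + (∫ z in spaceTime n, u z.1 z.2 * deriv (fun s => φ s z.2) z.1)
      + (∫ z in spaceTime n, u z.1 z.2 * (G.subLaplacian (φ z.1) z.2
          + lam * G.gradSq d z.2 / d z.2 ^ 2 * φ z.1 z.2)) = 0

end

open Filter Topology

noncomputable section

/-! ### Dilations, Lebesgue measure and horizontal vector fields -/

namespace StratifiedLieGroup

variable {n : ℕ} (G : StratifiedLieGroup n)

/-! The proof is the test function method at the parabolic scale of the dilations. Problem (2)
reduces to (1) by the ground state transform `w = d^α u`. Harmonicity of `d^(2-Q)` says `Δd =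
(Q-1)|∇d|²/d`, and `α` is a root of `α² - (Q-2)α + λ`, so `d^(-α)` is annihilated by `Δ +
λ|∇d|²/d²`. Conjugating by this function turns the Hardy operator into `d^α ∇(d^(-2α) ∇ ·)`
(`IsGauge.hardy_conjugation`), and the two weak formulations agree up to null sets.

For (1), test with `ψ(t,x) = η(r² t) ζ(δ_r x)`. The cutoff `η` lives on `[1,3]`, so the initial
datum drops out. The cutoff `ζ` equals `1` near the origin, so the singular weight is never
differentiated there. Both are high powers of bumps, which bounds `|ψ_t|` and `d^(2α)|∇(d^(-2α)∇ψ)|`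
by constants times `r² ψ^(1/p)`. Young's inequality (`weighted_young`) absorbs the terms linear in
`w` into the `w^p` term, at the cost of `(C r²)^q d^(-α)` on the support of `ψ`, where `1/p + 1/q =
1`. Since `α < Q`, `d^(-α)` is locally integrable, and its mass on that support scales like `r^(-2)
r^(α-Q)`.

Dividing out the length `r^(-2)` of the time interval leaves `(∫ η) ∫ d^(-α) f ζ(δ_r x) dx ≤ C
r^(2q+α-Q)` (`IsGauge.exists_scaled_bound`). The subcritical condition on `p` says exactly that the
exponent is positive. Letting `r → 0` makes the right side vanish, while the left side tends to a
positive multiple of `∫ d^(-α) f > 0`, a contradiction. -/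

lemma dilation_dilation (r s : ℝ) (x : Fin n → ℝ) :
    G.dilation r (G.dilation s x) = G.dilation (r * s) x := by
  funext i
  simp [dilation, mul_pow, _root_.mul_assoc]

lemma dilation_one (x : Fin n → ℝ) : G.dilation 1 x = x := by
  funext i
  simp [dilation]

lemma dilation_origin (r : ℝ) : G.dilation r 0 = 0 := by
  funext i
  simp [dilation]

lemma weight_ne_zero (i : Fin n) : G.weight i ≠ 0 :=
  Nat.one_le_iff_ne_zero.mp (G.weight_pos i)

lemma dilation_zero (x : Fin n → ℝ) : G.dilation 0 x = 0 := by
  funext i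
  simp [dilation, G.weight_ne_zero i]

/-- The dilation as a continuous linear map. -/
def dilationL (r : ℝ) : (Fin n → ℝ) →L[ℝ] (Fin n → ℝ) :=
  ContinuousLinearMap.pi fun i => (r ^ G.weight i) • ContinuousLinearMap.proj i

lemma dilationL_apply (r : ℝ) (x : Fin n → ℝ) : G.dilationL r x = G.dilation r x := by
  funext i
  simp [dilationL, dilation]

lemma hasFDerivAt_dilation (r : ℝ) (x : Fin n → ℝ) :
    HasFDerivAt (G.dilation r) (G.dilationL r) x := by
  have : G.dilation r = G.dilationL r := by
    funext x
    exact (G.dilationL_apply r x).symm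
  rw [this]
  exact (G.dilationL r).hasFDerivAt

lemma contDiff_dilation (r : ℝ) : ContDiff ℝ ∞ (G.dilation r) := by
  have : G.dilation r = G.dilationL r := by
    funext x
    exact (G.dilationL_apply r x).symm
  rw [this]
  exact (G.dilationL r).contDiff

lemma continuous_dilation_left (x : Fin n → ℝ) : Continuous fun r => G.dilation r x := by
  unfold dilation
  fun_prop

/-- The dilation by a positive factor as a homeomorphism. -/
def dilationHomeomorph {r : ℝ} (hr : 0 < r) : (Fin n → ℝ) ≃ₜ (Fin n → ℝ) where
  toFun := G.dilation r
  invFun := G.dilation r⁻¹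
  left_inv x := by rw [dilation_dilation, inv_mul_cancel₀ hr.ne', dilation_one]
  right_inv x := by rw [dilation_dilation, mul_inv_cancel₀ hr.ne', dilation_one]
  continuous_toFun := (G.contDiff_dilation r).continuous
  continuous_invFun := (G.contDiff_dilation r⁻¹).continuous

lemma map_dilation_volume {r : ℝ} (hr : 0 < r) :
    Measure.map (G.dilation r) volume = ENNReal.ofReal ((r ^ G.homDim)⁻¹) • volume := by
  have hdet : (Matrix.diagonal fun i => r ^ G.weight i).det = r ^ G.homDim := by
    rw [Matrix.det_diagonal, Finset.prod_pow_eq_pow_sum]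
    rfl
  have hpos : 0 < r ^ G.homDim := pow_pos hr _
  have key := Real.smul_map_diagonal_volume_pi (D := fun i => r ^ G.weight i)
    (by rw [hdet]; exact hpos.ne')
  have hfun : (Matrix.toLin' (Matrix.diagonal fun i => r ^ G.weight i) :
      (Fin n → ℝ) → (Fin n → ℝ)) = G.dilation r := by
    funext x i
    simp [dilation, Matrix.mulVec_diagonal]
  rw [hdet, hfun, abs_of_pos hpos] at key
  conv_rhs => rw [← key]
  rw [smul_smul, ← ENNReal.ofReal_mul (inv_nonneg.mpr hpos.le), inv_mul_cancel₀ hpos.ne']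
  simp

lemma lintegral_comp_dilation {r : ℝ} (hr : 0 < r) (g : (Fin n → ℝ) → ENNReal) :
    ∫⁻ x, g (G.dilation r x) = ENNReal.ofReal ((r ^ G.homDim)⁻¹) * ∫⁻ x, g x := by
  rw [← smul_eq_mul, ← lintegral_smul_measure, ← G.map_dilation_volume hr]
  exact ((G.dilationHomeomorph hr).measurableEmbedding.lintegral_map g).symm

lemma contDiff_leftField (k : Fin n) : ContDiff ℝ ∞ (leftField G.mul k) := by
  have h : ContDiff ℝ ∞ (fun x => fderiv ℝ (G.mul x) 0) :=
    ContDiff.fderiv (m := ∞) (n := ∞) (f := G.mul) (g := fun _ => 0) G.contDiff_mul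
      contDiff_const (by simp)
  exact h.clm_apply contDiff_const

/-- Differentiate `δ_r(x ∘ y) = δ_r x ∘ δ_r y` in `y` at the origin. Weight one makes `e_k` an
eigenvector of `δ_r` with eigenvalue `r`, so horizontal fields are homogeneous of degree one. -/
lemma dilationL_leftField {r : ℝ} (hr : 0 < r) {k : Fin n} (hk : G.weight k = 1)
    (x : Fin n → ℝ) :
    G.dilationL r (leftField G.mul k x) = r • leftField G.mul k (G.dilation r x) := by
  have hdiff : ∀ y z, DifferentiableAt ℝ (G.mul y) z := fun y z =>
    ((G.contDiff_mul.comp (contDiff_const.prodMk contDiff_id)).differentiable (by simp)) z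
  have heq : (fun y => G.dilation r (G.mul x y)) =
      fun y => G.mul (G.dilation r x) (G.dilation r y) := by
    funext y
    exact G.dilation_mul r hr x y
  have h1 : HasFDerivAt (fun y => G.dilation r (G.mul x y))
      ((G.dilationL r).comp (fderiv ℝ (G.mul x) 0)) 0 :=
    (G.hasFDerivAt_dilation r _).comp 0 (hdiff x 0).hasFDerivAt
  have h2 : HasFDerivAt (fun y => G.mul (G.dilation r x) (G.dilation r y))
      ((fderiv ℝ (G.mul (G.dilation r x)) 0).comp (G.dilationL r)) 0 := by
    have := (hdiff (G.dilation r x) (G.dilation r 0)).hasFDerivAt.comp 0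
      (G.hasFDerivAt_dilation r 0)
    rwa [dilation_origin] at this
  rw [heq] at h1
  have h3 := congrArg (fun L => L (Pi.single k 1)) (h1.unique h2)
  have h4 : G.dilationL r (Pi.single k 1) = r • (Pi.single k 1 : Fin n → ℝ) := by
    funext i
    rw [dilationL_apply]
    by_cases hi : i = k
    · subst hi
      simp [dilation, hk]
    · simp [dilation, hi]
  simpa [leftField, h4] using h3

lemma X_comp_dilation {r : ℝ} (hr : 0 < r) {k : Fin n} (hk : G.weight k = 1)
    {u : (Fin n → ℝ) → ℝ} (hu : Differentiable ℝ u) (x : Fin n → ℝ) :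
    G.X k (fun y => u (G.dilation r y)) x = r * G.X k u (G.dilation r x) := by
  have h : HasFDerivAt (fun y => u (G.dilation r y))
      ((fderiv ℝ u (G.dilation r x)).comp (G.dilationL r)) x :=
    (hu _).hasFDerivAt.comp x (G.hasFDerivAt_dilation r x)
  simp [X, h.fderiv, G.dilationL_leftField hr hk]

/-! ### Local integrability of negative powers of the gauge -/

variable {G} {d : (Fin n → ℝ) → ℝ}

lemma IsGauge.nonneg (hd : G.IsGauge d) (x : Fin n → ℝ) : 0 ≤ d x := by
  by_cases hx : x = 0
  · rw [hx, hd.zero]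
  · exact (hd.pos x hx).le

lemma IsGauge.rpow_dilation (hd : G.IsGauge d) {r : ℝ} (hr : 0 < r) (s : ℝ) (x : Fin n → ℝ) :
    d (G.dilation r x) ^ s = r ^ s * d x ^ s := by
  rw [hd.dilation r hr, Real.mul_rpow hr.le (hd.nonneg x)]

/-- Homogeneity of `d` contributes `r^s` and the Jacobian `r^(-Q)`. The lower integral makes this
available before any integrability is known. -/
lemma IsGauge.setLIntegral_dilation_preimage (hd : G.IsGauge d) {r : ℝ} (hr : 0 < r) (s : ℝ)
    {A : Set (Fin n → ℝ)} (hA : MeasurableSet A) :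
    ∫⁻ x in G.dilation r ⁻¹' A, ENNReal.ofReal (d x ^ (-s)) =
      ENNReal.ofReal (r ^ (s - G.homDim)) * ∫⁻ x in A, ENNReal.ofReal (d x ^ (-s)) := by
  have hm : MeasurableSet (G.dilation r ⁻¹' A) := (G.contDiff_dilation r).continuous.measurable hA
  rw [← lintegral_indicator hm, ← lintegral_indicator hA]
  have h : ∀ x, (G.dilation r ⁻¹' A).indicator (fun x => ENNReal.ofReal (d x ^ (-s))) x =
      ENNReal.ofReal (r ^ s) *
        A.indicator (fun x => ENNReal.ofReal (d x ^ (-s))) (G.dilation r x) := by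
    intro x
    by_cases hx : G.dilation r x ∈ A
    · rw [indicator_of_mem (show x ∈ G.dilation r ⁻¹' A from hx), indicator_of_mem hx,
        ← ENNReal.ofReal_mul (by positivity), hd.rpow_dilation hr, ← _root_.mul_assoc,
        ← Real.rpow_add hr]
      simp
    · rw [indicator_of_notMem (show x ∉ G.dilation r ⁻¹' A from hx), indicator_of_notMem hx,
        MulZeroClass.mul_zero]
  simp_rw [h]
  rw [lintegral_const_mul' _ _ ENNReal.ofReal_ne_top, G.lintegral_comp_dilation hr,
    ← _root_.mul_assoc, ← ENNReal.ofReal_mul (by positivity), Real.rpow_sub hr, Real.rpow_natCast, div_eq_mul_inv]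

/-- Take the last dyadic dilate before the orbit first leaves the unit ball. The shell is compact
and misses the origin, so negative powers of `d` are bounded on it. -/
lemma exists_dilation_mem_shell {x : Fin n → ℝ} (hx : x ∈ Metric.closedBall 0 1) (hx0 : x ≠ 0) :
    ∃ k : ℕ, G.dilation (2 ^ k) x ∈
      Metric.closedBall 0 1 ∩ G.dilation 2 ⁻¹' (Metric.ball 0 1)ᶜ := by
  have hex : ∃ k : ℕ, G.dilation (2 ^ k) x ∉ Metric.closedBall 0 1 := by
    obtain ⟨i, hi⟩ := Function.ne_iff.mp hx0
    obtain ⟨k, hk⟩ := pow_unbounded_of_one_lt (1 / |x i|) (one_lt_two (α := ℝ))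
    have hi' : 0 < |x i| := abs_pos.mpr hi
    refine ⟨k, fun hmem => ?_⟩
    rw [mem_closedBall_zero_iff] at hmem
    have h1 : |G.dilation (2 ^ k) x i| ≤ 1 := (norm_le_pi_norm _ i).trans hmem
    have h2 : (2 : ℝ) ^ k ≤ (2 ^ k) ^ G.weight i :=
      le_self_pow₀ (one_le_pow₀ one_le_two) (G.weight_ne_zero i)
    rw [dilation, abs_mul, abs_of_pos (by positivity)] at h1
    rw [div_lt_iff₀ hi'] at hk
    nlinarith
  classical
  have hpos : Nat.find hex ≠ 0 := by
    intro h0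
    have := Nat.find_spec hex
    rw [h0, pow_zero, dilation_one] at this
    exact this hx
  obtain ⟨m, hm⟩ := Nat.exists_eq_succ_of_ne_zero hpos
  refine ⟨m, ?_, ?_⟩
  · have := Nat.find_min hex (m := m) (by omega)
    simpa using this
  · have := Nat.find_spec hex
    rw [hm, Nat.succ_eq_add_one, pow_succ', ← dilation_dilation] at this
    exact fun h => this (Metric.ball_subset_closedBall h)

/-- The ball minus the origin is covered by dyadic preimages of one shell, whose integrals form a
geometric series of ratio `2^(s-Q) < 1`. -/
lemma IsGauge.integrableOn_unitBall (hd : G.IsGauge d) [NeZero n] {s : ℝ} (hs : s < G.homDim) :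
    IntegrableOn (fun x => d x ^ (-s)) (Metric.closedBall 0 1) := by
  have hmeas : Measurable fun x => d x ^ (-s) := hd.continuous.measurable.pow_const _
  set A : Set (Fin n → ℝ) := Metric.closedBall 0 1 ∩ G.dilation 2 ⁻¹' (Metric.ball 0 1)ᶜ with hA
  have hAc : IsCompact A := (isCompact_closedBall 0 1).inter_right
    (Metric.isOpen_ball.isClosed_compl.preimage (G.contDiff_dilation 2).continuous)
  have hA0 : ∀ x ∈ A, x ≠ 0 := by
    rintro x ⟨-, hx⟩ rfl
    simp [dilation_origin] at hx
  have hAfin : ∫⁻ x in A, ENNReal.ofReal (d x ^ (-s)) ≠ ⊤ := by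
    have hc : ContinuousOn (fun x => d x ^ (-s)) A :=
      hd.continuous.continuousOn.rpow_const fun x hx => Or.inl (hd.pos x (hA0 x hx)).ne'
    have hi := hc.integrableOn_compact (μ := volume) hAc
    exact hi.lintegral_lt_top.ne
  refine ⟨hmeas.aestronglyMeasurable, ?_⟩
  rw [hasFiniteIntegral_iff_ofReal (ae_of_all _ fun x => Real.rpow_nonneg (hd.nonneg x) _)]
  have hsub : Metric.closedBall 0 1 ⊆
      ({0} : Set (Fin n → ℝ)) ∪ ⋃ k : ℕ, G.dilation (2 ^ k) ⁻¹' A := by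
    intro x hx
    by_cases hx0 : x = 0
    · exact Or.inl hx0
    · exact Or.inr (mem_iUnion.mpr (exists_dilation_mem_shell hx hx0))
  set c : ENNReal := ENNReal.ofReal (2 ^ (s - G.homDim)) with hc
  have hc1 : c < 1 := by
    rw [hc, ENNReal.ofReal_lt_one]
    exact Real.rpow_lt_one_of_one_lt_of_neg one_lt_two (by linarith)
  calc ∫⁻ x in Metric.closedBall 0 1, ENNReal.ofReal (d x ^ (-s))
      ≤ ∫⁻ x in ({0} : Set (Fin n → ℝ)) ∪ ⋃ k : ℕ, G.dilation (2 ^ k) ⁻¹' A,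
          ENNReal.ofReal (d x ^ (-s)) := lintegral_mono_set hsub
    _ ≤ (∫⁻ x in ({0} : Set (Fin n → ℝ)), ENNReal.ofReal (d x ^ (-s))) +
          ∫⁻ x in ⋃ k : ℕ, G.dilation (2 ^ k) ⁻¹' A, ENNReal.ofReal (d x ^ (-s)) :=
        lintegral_union_le _ _ _
    _ = ∫⁻ x in ⋃ k : ℕ, G.dilation (2 ^ k) ⁻¹' A, ENNReal.ofReal (d x ^ (-s)) := by
        rw [setLIntegral_measure_zero _ _ (by simp), zero_add]
    _ ≤ ∑' k : ℕ, ∫⁻ x in G.dilation (2 ^ k) ⁻¹' A, ENNReal.ofReal (d x ^ (-s)) :=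
        lintegral_iUnion_le _ _
    _ = ∑' k : ℕ, c ^ k * ∫⁻ x in A, ENNReal.ofReal (d x ^ (-s)) := by
        congr 1
        funext k
        rw [hd.setLIntegral_dilation_preimage (by positivity) s hAc.measurableSet, hc,
          ← ENNReal.ofReal_pow (by positivity), ← Real.rpow_natCast, ← Real.rpow_mul zero_le_two,
          ← Real.rpow_natCast (2 ^ _), ← Real.rpow_mul zero_le_two, mul_comm (k : ℝ)]
    _ = (1 - c)⁻¹ * ∫⁻ x in A, ENNReal.ofReal (d x ^ (-s)) := by
        rw [ENNReal.tsum_mul_right, ENNReal.tsum_geometric]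
    _ < ⊤ := ENNReal.mul_lt_top
        (ENNReal.inv_lt_top.mpr (tsub_pos_of_lt hc1)) hAfin.lt_top

lemma IsGauge.integrableOn_dilation_preimage (hd : G.IsGauge d) [NeZero n] {s : ℝ}
    (hs : s < G.homDim) {r : ℝ} (hr : 0 < r) :
    IntegrableOn (fun x => d x ^ (-s)) (G.dilation r ⁻¹' Metric.closedBall 0 1) := by
  have hmeas : Measurable fun x => d x ^ (-s) := hd.continuous.measurable.pow_const _
  refine ⟨hmeas.aestronglyMeasurable, ?_⟩
  rw [hasFiniteIntegral_iff_ofReal (ae_of_all _ fun x => Real.rpow_nonneg (hd.nonneg x) _),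
    hd.setLIntegral_dilation_preimage hr s Metric.isClosed_closedBall.measurableSet]
  exact ENNReal.mul_lt_top ENNReal.ofReal_lt_top
    (hd.integrableOn_unitBall hs).lintegral_lt_top

lemma IsGauge.setIntegral_dilation_preimage (hd : G.IsGauge d) {r : ℝ} (hr : 0 < r) (s : ℝ) :
    ∫ x in G.dilation r ⁻¹' Metric.closedBall 0 1, d x ^ (-s) =
      r ^ (s - G.homDim) * ∫ x in Metric.closedBall 0 1, d x ^ (-s) := by
  have hmeas : Measurable fun x => d x ^ (-s) := hd.continuous.measurable.pow_const _
  have hnn : ∀ x, 0 ≤ d x ^ (-s) := fun x => Real.rpow_nonneg (hd.nonneg x) _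
  rw [integral_eq_lintegral_of_nonneg_ae (ae_of_all _ hnn) hmeas.aestronglyMeasurable,
    integral_eq_lintegral_of_nonneg_ae (ae_of_all _ hnn) hmeas.aestronglyMeasurable,
    hd.setLIntegral_dilation_preimage hr s Metric.isClosed_closedBall.measurableSet,
    ENNReal.toReal_mul, ENNReal.toReal_ofReal (by positivity)]

end StratifiedLieGroup

/-! ### Cutoffs adapted to the weighted operator -/

namespace StratifiedLieGroup

variable {n : ℕ} {G : StratifiedLieGroup n} {d : (Fin n → ℝ) → ℝ}

lemma contDiffAt_X (k : Fin n) {u : (Fin n → ℝ) → ℝ} {x : Fin n → ℝ} (hu : ContDiffAt ℝ ∞ u x) :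
    ContDiffAt ℝ ∞ (G.X k u) x :=
  (hu.fderiv_right (m := ∞) (by simp)).clm_apply (G.contDiff_leftField k).contDiffAt

lemma contDiff_X (k : Fin n) {u : (Fin n → ℝ) → ℝ} (hu : ContDiff ℝ ∞ u) :
    ContDiff ℝ ∞ (G.X k u) :=
  contDiff_iff_contDiffAt.mpr fun _ => contDiffAt_X k hu.contDiffAt

lemma X_mul (k : Fin n) {u v : (Fin n → ℝ) → ℝ} {x : Fin n → ℝ} (hu : DifferentiableAt ℝ u x)
    (hv : DifferentiableAt ℝ v x) :
    G.X k (fun y => u y * v y) x = u x * G.X k v x + v x * G.X k u x := by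
  have h : HasFDerivAt (fun y => u y * v y) _ x := hu.hasFDerivAt.mul hv.hasFDerivAt
  simp [X, h.fderiv]

lemma X_const_mul (k : Fin n) (c : ℝ) {v : (Fin n → ℝ) → ℝ} {x : Fin n → ℝ}
    (hv : DifferentiableAt ℝ v x) :
    G.X k (fun y => c * v y) x = c * G.X k v x := by
  simp [X, (hv.hasFDerivAt.const_mul c).fderiv]

lemma X_pow (k : Fin n) (m : ℕ) {u : (Fin n → ℝ) → ℝ} {x : Fin n → ℝ}
    (hu : DifferentiableAt ℝ u x) :
    G.X k (fun y => u y ^ (m + 1)) x = (m + 1) * u x ^ m * G.X k u x := by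
  simp [X, (hu.hasFDerivAt.pow (m + 1)).fderiv]

lemma X_congr (k : Fin n) {u v : (Fin n → ℝ) → ℝ} {x : Fin n → ℝ} (h : u =ᶠ[𝓝 x] v) :
    G.X k u x = G.X k v x := by
  simp [X, h.fderiv_eq]

lemma IsGauge.contDiffAt (hd : G.IsGauge d) {x : Fin n → ℝ} (hx : x ≠ 0) :
    ContDiffAt ℝ ∞ d x :=
  hd.smooth.contDiffAt (isOpen_compl_singleton.mem_nhds hx)

lemma IsGauge.contDiffAt_rpow (hd : G.IsGauge d) {x : Fin n → ℝ} (hx : x ≠ 0) (s : ℝ) :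
    ContDiffAt ℝ ∞ (fun y => d y ^ s) x :=
  (hd.contDiffAt hx).rpow_const_of_ne (hd.pos x hx).ne'

/-- The singularity of `d^s` at the origin is harmless because `b` is constant there, so the product
vanishes nearby. -/
lemma IsGauge.contDiff_rpow_mul_X (hd : G.IsGauge d) (k : Fin n) (s : ℝ) {b : (Fin n → ℝ) → ℝ}
    (hb : ContDiff ℝ ∞ b) (hb1 : b =ᶠ[𝓝 0] fun _ => 1) :
    ContDiff ℝ ∞ (fun y => d y ^ s * G.X k b y) := by
  rw [contDiff_iff_contDiffAt]
  intro x
  by_cases hx : x = 0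
  · subst hx
    have h : (fun y => d y ^ s * G.X k b y) =ᶠ[𝓝 0] fun _ => 0 := by
      filter_upwards [hb1.eventuallyEq_nhds] with y hy
      rw [X_congr k hy]
      simp [X]
    exact contDiffAt_const.congr_of_eventuallyEq h
  · exact (hd.contDiffAt_rpow hx s).mul (contDiff_X k hb).contDiffAt

/-- The factor left over when `b ^ m` is taken out of `∇ · (d ^ s ∇ b ^ (m + 2))`. -/
def powDivGrad (G : StratifiedLieGroup n) (d b : (Fin n → ℝ) → ℝ) (s : ℝ) (m : ℕ)
    (x : Fin n → ℝ) : ℝ :=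
  (m + 2) * ∑ k ∈ G.horizontal, (b x * G.X k (fun y => d y ^ s * G.X k b y) x +
    (m + 1) * (d x ^ s * G.X k b x) * G.X k b x)

/-- Two derivatives cost at most two powers of `b`, so `b^m` survives as a common factor. -/
lemma IsGauge.divGrad_pow (hd : G.IsGauge d) (s : ℝ) (m : ℕ) {b : (Fin n → ℝ) → ℝ}
    (hb : ContDiff ℝ ∞ b) (hb1 : b =ᶠ[𝓝 0] fun _ => 1) (x : Fin n → ℝ) :
    G.divGrad (fun y => d y ^ s) (fun y => b y ^ (m + 2)) x = b x ^ m * powDivGrad G d b s m x := by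
  have hbd : Differentiable ℝ b := hb.differentiable (by simp)
  unfold divGrad powDivGrad
  rw [Finset.mul_sum, Finset.mul_sum]
  refine Finset.sum_congr rfl fun k _ => ?_
  have hv : Differentiable ℝ (fun y => d y ^ s * G.X k b y) :=
    (hd.contDiff_rpow_mul_X k s hb hb1).differentiable (by simp)
  have h1 : (fun y => d y ^ s * G.X k (fun z => b z ^ (m + 2)) y) =
      fun y => (m + 2 : ℝ) * (b y ^ (m + 1) * (d y ^ s * G.X k b y)) := by
    funext y
    rw [X_pow k (m + 1) (hbd y)]
    push_cast
    ring
  have hd1 : DifferentiableAt ℝ (fun y => b y ^ (m + 1) * (d y ^ s * G.X k b y)) x :=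
    ((hbd x).pow (m + 1)).mul (hv x)
  rw [h1, X_const_mul k _ hd1,
    X_mul k (u := fun y => b y ^ (m + 1)) ((hbd x).pow (m + 1)) (hv x), X_pow k m (hbd x)]
  ring

lemma IsGauge.continuous_powDivGrad (hd : G.IsGauge d) (s : ℝ) (m : ℕ) {b : (Fin n → ℝ) → ℝ}
    (hb : ContDiff ℝ ∞ b) (hb1 : b =ᶠ[𝓝 0] fun _ => 1) :
    Continuous (powDivGrad G d b s m) := by
  unfold powDivGrad
  refine continuous_const.mul (continuous_finsetSum _ fun k _ => ?_)
  have hv := hd.contDiff_rpow_mul_X k s hb hb1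
  exact (hb.continuous.mul (contDiff_X k hv).continuous).add
    ((continuous_const.mul hv.continuous).mul (contDiff_X k hb).continuous)

/-- The two horizontal derivatives give `r²`, and moving the weight to the dilated point gives
`r^(-s)`. -/
lemma IsGauge.divGrad_comp_dilation (hd : G.IsGauge d) (s : ℝ) {ζ : (Fin n → ℝ) → ℝ}
    (hζ : ContDiff ℝ ∞ ζ) (hζ1 : ζ =ᶠ[𝓝 0] fun _ => 1) {r : ℝ} (hr : 0 < r) (x : Fin n → ℝ) :
    G.divGrad (fun y => d y ^ s) (fun y => ζ (G.dilation r y)) x =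
      r ^ (2 - s) * G.divGrad (fun y => d y ^ s) ζ (G.dilation r x) := by
  unfold divGrad
  rw [Finset.mul_sum]
  refine Finset.sum_congr rfl fun k hk => ?_
  have hk1 : G.weight k = 1 := (Finset.mem_filter.mp hk).2
  have hv : Differentiable ℝ (fun y => d y ^ s * G.X k ζ y) :=
    (hd.contDiff_rpow_mul_X k s hζ hζ1).differentiable (by simp)
  have h1 : (fun y => d y ^ s * G.X k (fun z => ζ (G.dilation r z)) y) =
      fun y => r ^ (1 - s) *
        (fun y => d y ^ s * G.X k ζ y) (G.dilation r y) := by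
    funext y
    rw [G.X_comp_dilation hr hk1 (hζ.differentiable (by simp))]
    simp only
    rw [hd.rpow_dilation hr, Real.rpow_sub hr, Real.rpow_one]
    field_simp
  have hd1 : DifferentiableAt ℝ
      (fun y => (fun z => d z ^ s * G.X k ζ z) (G.dilation r y)) x :=
    (hv _).comp x (G.hasFDerivAt_dilation r x).differentiableAt
  rw [h1, X_const_mul k _ hd1, G.X_comp_dilation hr hk1 hv, ← _root_.mul_assoc]
  congr 1
  rw [show 2 - s = (1 - s) + 1 by ring, Real.rpow_add hr, Real.rpow_one]

lemma pow_le_rpow_of_le_one {p : ℝ} (hp : 1 < p) {m : ℕ} (hm : ((m : ℝ) + 2) / p ≤ m) {b : ℝ}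
    (h0 : 0 ≤ b) (h1 : b ≤ 1) : b ^ m ≤ (b ^ (m + 2)) ^ (1 / p) := by
  rcases h0.eq_or_lt with rfl | hb
  · have hm0 : m ≠ 0 := by
      rintro rfl
      have : 0 < ((0 : ℕ) + 2 : ℝ) / p := by positivity
      simp at hm
      linarith [show 0 < 2 / p by positivity]
    rw [zero_pow hm0]
    positivity
  · rw [← Real.rpow_natCast b (m + 2), ← Real.rpow_mul h0, ← Real.rpow_natCast b m]
    refine Real.rpow_le_rpow_of_exponent_ge hb h1 ?_
    push_cast
    rw [mul_one_div]
    exact hm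

lemma exists_exponent {p : ℝ} (hp : 1 < p) : ∃ m : ℕ, m ≠ 0 ∧ ((m : ℝ) + 2) / p ≤ m := by
  obtain ⟨m, hm⟩ := exists_nat_ge (2 / (p - 1))
  have hp' : 0 < p - 1 := by linarith
  have hm1 : 0 < 2 / (p - 1) := by positivity
  refine ⟨m, ?_, ?_⟩
  · rintro rfl
    simp at hm
    linarith
  · rw [div_le_iff₀ hp'] at hm
    rw [div_le_iff₀ (by linarith)]
    linarith

/-- A spatial cutoff for which `d ^ (2α) |∇ · (d ^ (-2α) ∇ ζ)|` is controlled by `ζ ^ (1/p)`. -/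
lemma IsGauge.exists_spatial_cutoff (hd : G.IsGauge d) {α p : ℝ} (hα : 0 < α) (hp : 1 < p) :
    ∃ ζ : (Fin n → ℝ) → ℝ, ContDiff ℝ ∞ ζ ∧ (∀ x, 0 ≤ ζ x) ∧ (∀ x, ζ x ≤ 1) ∧
      (ζ =ᶠ[𝓝 0] fun _ => 1) ∧ (∀ x, x ∉ Metric.closedBall 0 1 → ζ x = 0) ∧
      Continuous (fun x => d x ^ (2 * α) * G.divGrad (fun y => d y ^ (-2 * α)) ζ x) ∧
      ∃ C, 0 ≤ C ∧ ∀ x, |d x ^ (2 * α) * G.divGrad (fun y => d y ^ (-2 * α)) ζ x| ≤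
        C * ζ x ^ (1 / p) := by
  obtain ⟨m, hm0, hm⟩ := exists_exponent hp
  let b : ContDiffBump (0 : Fin n → ℝ) := ⟨1 / 2, 1, by norm_num, by norm_num⟩
  have hb : ContDiff ℝ ∞ b := b.contDiff
  have hb1 : (b : (Fin n → ℝ) → ℝ) =ᶠ[𝓝 0] fun _ => 1 := b.eventuallyEq_one
  have hbz : ∀ x, x ∉ Metric.closedBall 0 1 → b x = 0 := by
    intro x hx
    refine b.zero_of_le_dist ?_
    rw [Metric.mem_closedBall, not_le] at hx
    exact hx.le
  have hdc : Continuous fun x => d x ^ (2 * α) :=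
    hd.continuous.rpow_const fun _ => Or.inr (by positivity)
  have hgc : Continuous fun x => d x ^ (2 * α) * powDivGrad G d b (-2 * α) m x :=
    hdc.mul (hd.continuous_powDivGrad _ m hb hb1)
  obtain ⟨C, hC⟩ := (isCompact_closedBall (0 : Fin n → ℝ) 1).exists_bound_of_continuousOn
    hgc.continuousOn
  have heq : ∀ x, d x ^ (2 * α) * G.divGrad (fun y => d y ^ (-2 * α)) (fun y => b y ^ (m + 2)) x =
      b x ^ m * (d x ^ (2 * α) * powDivGrad G d b (-2 * α) m x) := by
    intro x
    rw [hd.divGrad_pow _ m hb hb1]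
    ring
  refine ⟨fun x => b x ^ (m + 2), hb.pow _, fun x => pow_nonneg b.nonneg _,
    fun x => pow_le_one₀ b.nonneg b.le_one, ?_, ?_, ?_, max C 0, le_max_right _ _, ?_⟩
  · filter_upwards [hb1] with x hx
    simp [hx]
  · intro x hx
    simp [hbz x hx]
  · simp_rw [heq]
    exact (hb.continuous.pow m).mul hgc
  · intro x
    rw [heq, abs_mul, abs_of_nonneg (pow_nonneg b.nonneg m)]
    by_cases hx : x ∈ Metric.closedBall 0 1
    · rw [mul_comm]
      exact mul_le_mul ((hC x hx).trans (le_max_left _ _))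
        (pow_le_rpow_of_le_one hp hm b.nonneg b.le_one) (pow_nonneg b.nonneg m) (le_max_right _ _)
    · rw [hbz x hx, zero_pow hm0, MulZeroClass.zero_mul]
      have := b.nonneg' x
      positivity

end StratifiedLieGroup

/-- A temporal cutoff supported away from `0` with `|η'|` controlled by `η ^ (1/p)`. -/
lemma exists_temporal_cutoff {p : ℝ} (hp : 1 < p) :
    ∃ η : ℝ → ℝ, ContDiff ℝ ∞ η ∧ (∀ t, 0 ≤ η t) ∧ (∀ t, η t ≤ 1) ∧
      (∀ t, t ∉ Icc (1 : ℝ) 3 → η t = 0) ∧ 0 < ∫ t, η t ∧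
      ∃ C, 0 ≤ C ∧ ∀ t, |deriv η t| ≤ C * η t ^ (1 / p) := by
  obtain ⟨m, hm0, hm⟩ := StratifiedLieGroup.exists_exponent hp
  -- Centre 2 and outer radius 1 keep the support inside `[1,3]`, away from `t = 0`.
  let b : ContDiffBump (2 : ℝ) := ⟨1 / 2, 1, by norm_num, by norm_num⟩
  have hb : ContDiff ℝ ∞ b := b.contDiff
  have hbz : ∀ t, t ∉ Icc (1 : ℝ) 3 → b t = 0 := by
    intro t ht
    refine b.zero_of_le_dist ?_
    by_contra hlt
    rw [not_le, Real.dist_eq, abs_lt] at hlt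
    have h1 : (b.rOut : ℝ) = 1 := rfl
    exact ht ⟨by linarith, by linarith⟩
  have hdb : Continuous fun t => ((m + 2 : ℕ) : ℝ) * b t * deriv b t :=
    (continuous_const.mul hb.continuous).mul (hb.continuous_deriv (by simp))
  obtain ⟨C, hC⟩ := (isCompact_Icc (a := (1 : ℝ)) (b := 3)).exists_bound_of_continuousOn
    hdb.continuousOn
  have hc : Continuous fun t => b t ^ (m + 2) := hb.continuous.pow _
  refine ⟨fun t => b t ^ (m + 2), hb.pow _, fun t => pow_nonneg b.nonneg _,
    fun t => pow_le_one₀ b.nonneg b.le_one, fun t ht => by simp [hbz t ht], ?_,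
    max C 0, le_max_right _ _, ?_⟩
  · refine hc.integral_pos_of_hasCompactSupport_nonneg_nonzero
      (HasCompactSupport.intro (isCompact_Icc (a := (1 : ℝ)) (b := 3)) fun t ht => by
        simp [hbz t ht]) (fun t => pow_nonneg b.nonneg _) (x := 2) ?_
    rw [b.one_of_mem_closedBall (Metric.mem_closedBall_self (by norm_num))]
    simp
  · intro t
    have hder : deriv (fun t => b t ^ (m + 2)) t =
        b t ^ m * (((m + 2 : ℕ) : ℝ) * b t * deriv b t) := by
      have h : HasDerivAt (fun t => b t ^ (m + 2)) _ t :=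
        (hb.differentiable (by simp) t).hasDerivAt.pow (m + 2)
      rw [h.deriv]
      simp only [Nat.add_succ_sub_one]
      ring
    rw [hder, abs_mul, abs_of_nonneg (pow_nonneg b.nonneg m)]
    by_cases ht : t ∈ Icc (1 : ℝ) 3
    · rw [mul_comm]
      exact mul_le_mul ((hC t ht).trans (le_max_left _ _))
        (StratifiedLieGroup.pow_le_rpow_of_le_one hp hm b.nonneg b.le_one)
        (pow_nonneg b.nonneg m) (le_max_right _ _)
    · rw [hbz t ht, zero_pow hm0, zero_mul]
      have := b.nonneg' t
      positivity

lemma isTestFunction_mul {n : ℕ} {η : ℝ → ℝ} {ζ : (Fin n → ℝ) → ℝ} (hη : ContDiff ℝ ∞ η)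
    (hηc : HasCompactSupport η) (hη0 : ∀ t, 0 ≤ η t) (hζ : ContDiff ℝ ∞ ζ)
    (hζc : HasCompactSupport ζ) (hζ0 : ∀ x, 0 ≤ ζ x) :
    IsTestFunction fun t x => η t * ζ x := by
  have hder : ∀ x t, deriv (fun s => η s * ζ x) t = deriv η t * ζ x := fun x t =>
    deriv_mul_const_field (ζ x)
  have hζ2 : ContDiff ℝ 2 ζ := contDiff_infty.mp hζ 2
  have hcont : ∀ (θ : ℝ → ℝ), Continuous θ → ∀ k : ℕ, k ≤ 2 →
      Continuous fun z : ℝ × (Fin n → ℝ) => iteratedFDeriv ℝ k (fun x => θ z.1 * ζ x) z.2 := by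
    intro θ hθ k hk
    have hζk : ContDiff ℝ k ζ := hζ2.of_le (by exact_mod_cast hk)
    have : (fun z : ℝ × (Fin n → ℝ) => iteratedFDeriv ℝ k (fun x => θ z.1 * ζ x) z.2) =
        fun z => θ z.1 • iteratedFDeriv ℝ k ζ z.2 := by
      funext z
      exact iteratedFDeriv_const_smul_apply (a := θ z.1) hζk.contDiffAt
    rw [this]
    exact (hθ.comp continuous_fst).smul
      ((hζk.continuous_iteratedFDeriv le_rfl).comp continuous_snd)
  refine ⟨?_, fun t _ x => mul_nonneg (hη0 t) (hζ0 x), fun t => contDiff_const.mul hζ2,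
    hcont η hη.continuous, fun x => (hη.differentiable (by simp)).mul_const _, ?_, ?_⟩
  · refine HasCompactSupport.intro (hηc.isCompact.prod hζc.isCompact) fun z hz => ?_
    rw [mem_prod, not_and_or] at hz
    rcases hz with hz | hz
    · simp [image_eq_zero_of_notMem_tsupport hz]
    · simp [image_eq_zero_of_notMem_tsupport hz]
  · intro t
    simp_rw [hder]
    exact contDiff_const.mul hζ2
  · intro k hk
    simp_rw [hder]
    exact hcont (deriv η) (hη.continuous_deriv (by simp)) k hk

/-! ### The ground state transform -/

namespace StratifiedLieGroup

variable {n : ℕ} {G : StratifiedLieGroup n} {d : (Fin n → ℝ) → ℝ}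

lemma differentiable_X (k : Fin n) {u : (Fin n → ℝ) → ℝ} (hu : ContDiff ℝ 2 u) :
    Differentiable ℝ (G.X k u) := by
  have h1 : ContDiff ℝ 1 (fderiv ℝ u) := hu.fderiv_right (by norm_num)
  exact (h1.clm_apply (contDiff_infty.mp (G.contDiff_leftField k) 1)).differentiable one_ne_zero

lemma IsGauge.X_rpow (hd : G.IsGauge d) (k : Fin n) (s : ℝ) {x : Fin n → ℝ} (hx : x ≠ 0) :
    G.X k (fun y => d y ^ s) x = s * d x ^ (s - 1) * G.X k d x := by
  have h := ((hd.contDiffAt hx).differentiableAt (by simp)).hasFDerivAt.rpow_const (p := s)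
    (Or.inl (hd.pos x hx).ne')
  simp [X, h.fderiv]

lemma IsGauge.X_X_rpow (hd : G.IsGauge d) (k : Fin n) (s : ℝ) {x : Fin n → ℝ} (hx : x ≠ 0) :
    G.X k (G.X k fun y => d y ^ s) x =
      s * d x ^ (s - 1) * G.X k (G.X k d) x + s * (s - 1) * d x ^ (s - 2) * G.X k d x ^ 2 := by
  have hev : (G.X k fun y => d y ^ s) =ᶠ[𝓝 x] fun y => s * (d y ^ (s - 1) * G.X k d y) := by
    filter_upwards [isOpen_compl_singleton.mem_nhds hx] with y hy
    rw [hd.X_rpow k s hy]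
    ring
  have h1 : DifferentiableAt ℝ (fun y => d y ^ (s - 1)) x :=
    (hd.contDiffAt_rpow hx _).differentiableAt (by simp)
  have h2 : DifferentiableAt ℝ (G.X k d) x :=
    (contDiffAt_X k (hd.contDiffAt hx)).differentiableAt (by simp)
  have h3 : DifferentiableAt ℝ (fun y => d y ^ (s - 1) * G.X k d y) x := h1.mul h2
  rw [X_congr k hev, X_const_mul k s h3, X_mul k h1 h2, hd.X_rpow k _ hx,
    show s - 1 - 1 = s - 2 by ring]
  ring

lemma IsGauge.subLaplacian_rpow (hd : G.IsGauge d) (s : ℝ) {x : Fin n → ℝ} (hx : x ≠ 0) :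
    G.subLaplacian (fun y => d y ^ s) x =
      s * d x ^ (s - 1) * G.subLaplacian d x + s * (s - 1) * d x ^ (s - 2) * G.gradSq d x := by
  unfold subLaplacian gradSq
  rw [Finset.mul_sum, Finset.mul_sum, ← Finset.sum_add_distrib]
  exact Finset.sum_congr rfl fun k _ => hd.X_X_rpow k s hx

/-- Expand `Δ(d^(2-Q)) = 0` by the chain rule and divide by the nonzero factor `(2-Q) d^(-Q)`. -/
lemma IsGauge.subLaplacian_eq (hd : G.IsGauge d) (hQ : 3 ≤ G.homDim) {x : Fin n → ℝ}
    (hx : x ≠ 0) : G.subLaplacian d x = (G.homDim - 1) * G.gradSq d x / d x := by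
  have hpos := hd.pos x hx
  have h := hd.harmonic x hx
  have hQ' : (3 : ℝ) ≤ G.homDim := by exact_mod_cast hQ
  rw [hd.subLaplacian_rpow _ hx,
    show (2 - (G.homDim : ℝ)) - 1 = (2 - G.homDim - 2) + 1 by ring, Real.rpow_add hpos,
    Real.rpow_one] at h
  have hfac : (2 - (G.homDim : ℝ)) * d x ^ (2 - (G.homDim : ℝ) - 2) *
      (d x * G.subLaplacian d x - (G.homDim - 1) * G.gradSq d x) = 0 := by
    rw [← h]
    ring
  have hne : (2 - (G.homDim : ℝ)) * d x ^ (2 - (G.homDim : ℝ) - 2) ≠ 0 :=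
    mul_ne_zero (by linarith) (Real.rpow_pos_of_pos hpos _).ne'
  have := (mul_eq_zero.mp hfac).resolve_left hne
  rw [eq_div_iff hpos.ne']
  linarith

/-- The cross terms `2 X_k(d^(-α)) X_k ψ` of the product rule are exactly `d^α X_k(d^(-2α)) X_k ψ`.
-/
lemma IsGauge.subLaplacian_rpow_mul (hd : G.IsGauge d) (α : ℝ) {ψ : (Fin n → ℝ) → ℝ}
    (hψ : ContDiff ℝ 2 ψ) {x : Fin n → ℝ} (hx : x ≠ 0) :
    G.subLaplacian (fun y => d y ^ (-α) * ψ y) x =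
      d x ^ α * G.divGrad (fun y => d y ^ (-2 * α)) ψ x +
        ψ x * G.subLaplacian (fun y => d y ^ (-α)) x := by
  have hpos := hd.pos x hx
  unfold subLaplacian divGrad
  rw [Finset.mul_sum, Finset.mul_sum, ← Finset.sum_add_distrib]
  refine Finset.sum_congr rfl fun k _ => ?_
  have hψd : Differentiable ℝ ψ := hψ.differentiable two_ne_zero
  have hXψ := differentiable_X (G := G) k hψ
  have hD : ∀ (s : ℝ) (y : Fin n → ℝ), y ≠ 0 →
      DifferentiableAt ℝ (fun y => d y ^ s) y := fun s y hy =>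
    (hd.contDiffAt_rpow hy s).differentiableAt (by simp)
  have hXD : DifferentiableAt ℝ (G.X k fun y => d y ^ (-α)) x :=
    (contDiffAt_X k (hd.contDiffAt_rpow hx _)).differentiableAt (by simp)
  have hev : (G.X k fun y => d y ^ (-α) * ψ y) =ᶠ[𝓝 x]
      fun y => (fun y => d y ^ (-α) * G.X k ψ y) y +
        (fun y => ψ y * G.X k (fun z => d z ^ (-α)) y) y := by
    filter_upwards [isOpen_compl_singleton.mem_nhds hx] with y hy
    exact X_mul k (hD _ y hy) (hψd y)
  have hadd : ∀ {u v : (Fin n → ℝ) → ℝ}, DifferentiableAt ℝ u x → DifferentiableAt ℝ v x →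
      G.X k (fun y => u y + v y) x = G.X k u x + G.X k v x := by
    intro u v hu hv
    have h : HasFDerivAt (fun y => u y + v y) _ x := hu.hasFDerivAt.add hv.hasFDerivAt
    simp [X, h.fderiv]
  have h2 : d x ^ α * d x ^ (-2 * α) = d x ^ (-α) := by
    rw [← Real.rpow_add hpos]
    ring_nf
  have h3 : d x ^ α * d x ^ (-2 * α - 1) = d x ^ (-α - 1) := by
    rw [← Real.rpow_add hpos]
    ring_nf
  have h4 : DifferentiableAt ℝ (fun y => d y ^ (-α) * G.X k ψ y) x := (hD _ x hx).mul (hXψ x)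
  have h5 : DifferentiableAt ℝ (fun y => ψ y * G.X k (fun z => d z ^ (-α)) y) x :=
    (hψd x).mul hXD
  rw [X_congr k hev, hadd h4 h5, X_mul k (hD _ x hx) (hXψ x),
    X_mul k (hψd x) hXD, X_mul k (hD _ x hx) (hXψ x), hd.X_rpow k _ hx, hd.X_rpow k _ hx,
    ← h2, ← h3]
  ring

lemma hardyExponent_root {lam : ℝ} (hlam : lam ≤ (((G.homDim : ℝ) - 2) / 2) ^ 2) :
    G.hardyExponent lam ^ 2 - (G.homDim - 2) * G.hardyExponent lam + lam = 0 := by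
  have h := Real.sq_sqrt (sub_nonneg.mpr hlam)
  unfold hardyExponent
  linear_combination h

lemma hardyExponent_pos (hQ : 3 ≤ G.homDim) {lam : ℝ} (h0 : 0 < lam) :
    0 < G.hardyExponent lam := by
  have hQ' : (3 : ℝ) ≤ G.homDim := by exact_mod_cast hQ
  unfold hardyExponent
  rw [sub_pos, Real.sqrt_lt' (by linarith)]
  linarith

lemma hardyExponent_lt (hQ : 3 ≤ G.homDim) (lam : ℝ) :
    G.hardyExponent lam < G.homDim - 2 := by
  have hQ' : (3 : ℝ) ≤ G.homDim := by exact_mod_cast hQ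
  unfold hardyExponent
  have := Real.sqrt_nonneg ((((G.homDim : ℝ) - 2) / 2) ^ 2 - lam)
  linarith

/-- The ground state transform: conjugation by `d ^ α` removes the Hardy potential. -/
lemma IsGauge.hardy_conjugation (hd : G.IsGauge d) (hQ : 3 ≤ G.homDim) {lam : ℝ}
    (hlam : lam ≤ (((G.homDim : ℝ) - 2) / 2) ^ 2) {ψ : (Fin n → ℝ) → ℝ}
    (hψ : ContDiff ℝ 2 ψ) {x : Fin n → ℝ} (hx : x ≠ 0) :
    G.subLaplacian (fun y => d y ^ (-G.hardyExponent lam) * ψ y) x +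
        lam * G.gradSq d x / d x ^ 2 * (d x ^ (-G.hardyExponent lam) * ψ x) =
      d x ^ G.hardyExponent lam *
        G.divGrad (fun y => d y ^ (-2 * G.hardyExponent lam)) ψ x := by
  have hpos := hd.pos x hx
  have hroot := hardyExponent_root (G := G) hlam
  set α := G.hardyExponent lam
  have h1 : d x ^ (-α) = d x ^ (-α - 2) * d x ^ 2 := by
    rw [← Real.rpow_natCast, ← Real.rpow_add hpos]
    congr 1
    push_cast
    ring
  have h2 : d x ^ (-α - 1) = d x ^ (-α - 2) * d x := by
    nth_rewrite 3 [← Real.rpow_one (d x)]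
    rw [← Real.rpow_add hpos]
    congr 1
    ring
  rw [hd.subLaplacian_rpow_mul α hψ hx, hd.subLaplacian_rpow _ hx, hd.subLaplacian_eq hQ hx, h1, h2]
  field_simp
  -- What remains is the quadratic polynomial satisfied by `α`, times `|∇d|² ψ d^(-α-2)`.
  linear_combination (G.gradSq d x * ψ x * d x ^ (-α - 2)) * hroot

lemma ae_ne_zero [NeZero n] : ∀ᵐ x : Fin n → ℝ, x ≠ 0 := by
  rw [ae_iff]
  simp

lemma ae_snd_ne_zero [NeZero n] : ∀ᵐ z : ℝ × (Fin n → ℝ), z.2 ≠ 0 :=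
  Measure.quasiMeasurePreserving_snd.ae ae_ne_zero

/-- Each integrand of one formulation equals its counterpart almost everywhere, off `x = 0` and
where `u ≥ 0`. Hence the absolute convergence premises transfer along with the identity. -/
lemma IsGauge.isGlobalWeakSolution_of_hardy [NeZero n] (hd : G.IsGauge d) (hQ : 3 ≤ G.homDim)
    {lam : ℝ} (hlam : lam ≤ (((G.homDim : ℝ) - 2) / 2) ^ 2) {p : ℝ} {f u₀ : (Fin n → ℝ) → ℝ}
    {u : ℝ → (Fin n → ℝ) → ℝ} (hu : IsGlobalWeakSolutionHardy G d lam p f u₀ u) :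
    IsGlobalWeakSolution G d (G.hardyExponent lam) p f
      (fun x => d x ^ G.hardyExponent lam * u₀ x)
      (fun t x => d x ^ G.hardyExponent lam * u t x) := by
  set α := G.hardyExponent lam with hα
  have hrpow : ∀ x, x ≠ 0 → d x ^ (-2 * α) * d x ^ α = d x ^ (-α) := by
    intro x hx
    rw [← Real.rpow_add (hd.pos x hx)]
    congr 1
    ring
  have hpow : ∀ (z : ℝ × (Fin n → ℝ)), z.2 ≠ 0 → 0 ≤ u z.1 z.2 →
      d z.2 ^ (-α * (p + 1)) * (d z.2 ^ α * u z.1 z.2) ^ p = d z.2 ^ (-α) * u z.1 z.2 ^ p := by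
    intro z hz hz0
    have hpos := hd.pos z.2 hz
    rw [Real.mul_rpow (by positivity) hz0, ← Real.rpow_mul hpos.le, ← _root_.mul_assoc,
      ← Real.rpow_add hpos]
    congr 2
    ring
  have hne : ∀ᵐ z ∂(volume.restrict (spaceTime n)), z.2 ≠ 0 :=
    ae_restrict_of_ae ae_snd_ne_zero
  have hloc : ∀ {F H : ℝ × (Fin n → ℝ) → ℝ}, F =ᵐ[volume.restrict (spaceTime n)] H →
      LocallyIntegrableOn F (spaceTime n) volume → LocallyIntegrableOn H (spaceTime n) volume := by
    intro F H hFH hF z hz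
    obtain ⟨U, hU, hFU⟩ := hF z hz
    refine ⟨spaceTime n ∩ U, inter_mem self_mem_nhdsWithin hU, ?_⟩
    exact (hFU.mono_set inter_subset_right).congr_fun_ae
      (ae_restrict_of_ae_restrict_of_subset inter_subset_left hFH)
  refine ⟨?_, ?_, ?_, ?_, ?_⟩
  · filter_upwards [hu.nonneg] with z hz
    exact mul_nonneg (Real.rpow_nonneg (hd.nonneg _) _) hz
  · refine hu.initial.congr ?_
    filter_upwards [ae_ne_zero] with x hx
    rw [← _root_.mul_assoc, hrpow x hx]
  · refine hloc ?_ hu.locL1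
    filter_upwards [hne] with z hz
    rw [← _root_.mul_assoc, hrpow z.2 hz]
  · refine hloc ?_ hu.locLp
    filter_upwards [hne, hu.nonneg] with z hz hz0
    exact (hpow z hz hz0).symm
  · intro ψ hψ i1 i2 i3
    have e1 : (fun z : ℝ × (Fin n → ℝ) => (d z.2 ^ (-α * (p + 1)) * (d z.2 ^ α * u z.1 z.2) ^ p +
        d z.2 ^ (-α) * f z.2) * ψ z.1 z.2) =ᵐ[volume.restrict (spaceTime n)]
        fun z => (u z.1 z.2 ^ p + f z.2) * (d z.2 ^ (-α) * ψ z.1 z.2) := by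
      filter_upwards [hne, hu.nonneg] with z hz hz0
      rw [hpow z hz hz0]
      ring
    have e2 : (fun z : ℝ × (Fin n → ℝ) => d z.2 ^ (-2 * α) * (d z.2 ^ α * u z.1 z.2) *
        deriv (fun s => ψ s z.2) z.1) =ᵐ[volume.restrict (spaceTime n)]
        fun z => u z.1 z.2 * deriv (fun s => d z.2 ^ (-α) * ψ s z.2) z.1 := by
      filter_upwards [hne] with z hz
      rw [deriv_const_mul_field, ← _root_.mul_assoc, hrpow z.2 hz]
      ring
    have e3 : (fun z : ℝ × (Fin n → ℝ) => d z.2 ^ α * u z.1 z.2 *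
        G.divGrad (fun y => d y ^ (-2 * α)) (ψ z.1) z.2) =ᵐ[volume.restrict (spaceTime n)]
        fun z => u z.1 z.2 * (G.subLaplacian (fun y => d y ^ (-α) * ψ z.1 y) z.2
          + lam * G.gradSq d z.2 / d z.2 ^ 2 * (d z.2 ^ (-α) * ψ z.1 z.2)) := by
      filter_upwards [hne] with z hz
      rw [hd.hardy_conjugation hQ hlam (hψ.space z.1) hz]
      ring
    have e0 : (fun x => d x ^ (-2 * α) * (d x ^ α * u₀ x) * ψ 0 x) =ᵐ[volume]
        fun x => u₀ x * (d x ^ (-α) * ψ 0 x) := by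
      filter_upwards [ae_ne_zero] with x hx
      rw [← _root_.mul_assoc, hrpow x hx]
      ring
    have key := hu.weak ψ (fun t x => d x ^ (-α) * ψ t x) hψ (fun t x => rfl)
      (i1.congr_fun_ae e1) (i2.congr_fun_ae e2) (i3.congr_fun_ae e3)
    rw [integral_congr_ae e1, integral_congr_ae e2, integral_congr_ae e3, integral_congr_ae e0]
    exact key

end StratifiedLieGroup

/-! ### The scaled test function estimate -/

lemma integrableOn_mul_of_locallyIntegrableOn {E : Type*} [TopologicalSpace E]
    [TopologicalSpace.PseudoMetrizableSpace E] [T2Space E] [MeasurableSpace E] [BorelSpace E]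
    {μ : Measure E} {F g : E → ℝ} {S K : Set E} (hF : LocallyIntegrableOn F S μ)
    (hK : IsCompact K) (hKS : K ⊆ S) (hg : Continuous g) (hg0 : ∀ z, z ∉ K → g z = 0) :
    IntegrableOn (fun z => F z * g z) S μ := by
  have h1 : IntegrableOn (fun z => F z * g z) K μ :=
    (hF.integrableOn_compact_subset hKS hK).mul_continuousOn hg.continuousOn hK
  rw [integrableOn_iff_integrable_of_support_subset] at h1
  · exact h1.integrableOn
  · intro z hz
    by_contra hzK
    exact hz (by simp [hg0 z hzK])

/-- Young's inequality with the weights that occur in the test function method. -/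
lemma weighted_young {p q : ℝ} (hpq : p.HolderConjugate q) (α : ℝ) {D w ψ c : ℝ} (hD : 0 < D)
    (hw : 0 ≤ w) (hψ : 0 ≤ ψ) (hc : 0 ≤ c) :
    D ^ (-2 * α) * w * (c * ψ ^ (1 / p)) ≤
      D ^ (-α * (p + 1)) * w ^ p * ψ + c ^ q * D ^ (-α) := by
  have hp := hpq.pos
  have hq := hpq.symm.pos
  have hinv : p⁻¹ + q⁻¹ = 1 := hpq.inv_add_inv_eq_one
  set a := D ^ (-α * (p + 1) / p) * w * ψ ^ (1 / p) with ha
  set b := c * D ^ (-α / q) with hb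
  have ha0 : 0 ≤ a := by positivity
  have hb0 : 0 ≤ b := by positivity
  have hab : D ^ (-2 * α) * w * (c * ψ ^ (1 / p)) = a * b := by
    -- The weight splits because `(p+1)/p + 1/q = 2`.
    have : D ^ (-2 * α) = D ^ (-α * (p + 1) / p) * D ^ (-α / q) := by
      rw [← Real.rpow_add hD]
      congr 1
      have : -α * (p + 1) / p + -α / q = -α * (p * p⁻¹ + (p⁻¹ + q⁻¹)) := by
        rw [div_eq_mul_inv, div_eq_mul_inv]
        ring
      rw [this, hinv, mul_inv_cancel₀ hp.ne']
      ring
    rw [this]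
    ring
  have hap : a ^ p = D ^ (-α * (p + 1)) * w ^ p * ψ := by
    rw [ha, Real.mul_rpow (by positivity) (by positivity), Real.mul_rpow (by positivity) hw,
      ← Real.rpow_mul hD.le, ← Real.rpow_mul hψ, div_mul_cancel₀ _ hp.ne',
      div_mul_cancel₀ _ hp.ne', Real.rpow_one]
  have hbq : b ^ q = c ^ q * D ^ (-α) := by
    rw [hb, Real.mul_rpow hc (by positivity), ← Real.rpow_mul hD.le, div_mul_cancel₀ _ hq.ne']
  rw [hab, ← hap, ← hbq]
  have h1 : a ^ p / p ≤ a ^ p := div_le_self (by positivity) hpq.lt.le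
  have h2 : b ^ q / q ≤ b ^ q := div_le_self (by positivity) hpq.symm.lt.le
  linarith [Real.young_inequality_of_nonneg ha0 hb0 hpq]

namespace StratifiedLieGroup

variable {n : ℕ} {G : StratifiedLieGroup n} {d : (Fin n → ℝ) → ℝ}

lemma IsGauge.divGrad_const_mul (hd : G.IsGauge d) (s c : ℝ) {ζ : (Fin n → ℝ) → ℝ}
    (hζ : ContDiff ℝ ∞ ζ) (hζ1 : ζ =ᶠ[𝓝 0] fun _ => 1) (x : Fin n → ℝ) :
    G.divGrad (fun y => d y ^ s) (fun y => c * ζ y) x =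
      c * G.divGrad (fun y => d y ^ s) ζ x := by
  unfold divGrad
  rw [Finset.mul_sum]
  refine Finset.sum_congr rfl fun k _ => ?_
  have hv : Differentiable ℝ (fun y => d y ^ s * G.X k ζ y) :=
    (hd.contDiff_rpow_mul_X k s hζ hζ1).differentiable (by simp)
  have h1 : (fun y => d y ^ s * G.X k (fun z => c * ζ z) y) =
      fun y => c * (d y ^ s * G.X k ζ y) := by
    funext y
    rw [X_const_mul k c (hζ.differentiable (by simp) y)]
    ring
  rw [h1, X_const_mul k c (hv x)]

/-- Dominated convergence: all weights are positive, so `δ_r x → 0` and the cutoff tends to `ζ 0 =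
1` pointwise. -/
lemma IsGauge.tendsto_integral_mul_cutoff {g ζ : (Fin n → ℝ) → ℝ} (hg : Integrable g)
    (hζ : Continuous ζ) (hζ0 : ∀ x, 0 ≤ ζ x) (hζ1 : ∀ x, ζ x ≤ 1) (hζ2 : ζ 0 = 1) :
    Tendsto (fun r => ∫ x, g x * ζ (G.dilation r x)) (𝓝[>] 0) (𝓝 (∫ x, g x)) := by
  refine tendsto_integral_filter_of_dominated_convergence (fun x => ‖g x‖) ?_ ?_ hg.norm ?_
  · exact Eventually.of_forall fun r => hg.aestronglyMeasurable.mul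
      (hζ.comp (G.contDiff_dilation r).continuous).aestronglyMeasurable
  · refine Eventually.of_forall fun r => ae_of_all _ fun x => ?_
    rw [norm_mul, Real.norm_of_nonneg (hζ0 _)]
    exact mul_le_of_le_one_right (norm_nonneg _) (hζ1 _)
  · refine ae_of_all _ fun x => ?_
    have h1 : Tendsto (fun r => ζ (G.dilation r x)) (𝓝[>] 0) (𝓝 (ζ (G.dilation 0 x))) :=
      ((hζ.comp (G.continuous_dilation_left x)).tendsto 0).mono_left nhdsWithin_le_nhds
    rw [dilation_zero, hζ2] at h1
    simpa using h1.const_mul (g x)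

/-- The scaled test function estimate satisfied by a global weak solution. -/
lemma IsGauge.exists_scaled_bound [NeZero n] (hd : G.IsGauge d) {α p q : ℝ} (hα : 0 < α)
    (hαQ : α < G.homDim) (hpq : p.HolderConjugate q) {f w₀ : (Fin n → ℝ) → ℝ}
    (hf : Integrable (fun x => d x ^ (-α) * f x)) {w : ℝ → (Fin n → ℝ) → ℝ}
    (hw : IsGlobalWeakSolution G d α p f w₀ w) :
    ∃ ζ : (Fin n → ℝ) → ℝ, Continuous ζ ∧ (∀ x, 0 ≤ ζ x) ∧ (∀ x, ζ x ≤ 1) ∧ ζ 0 = 1 ∧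
      ∃ m C : ℝ, 0 < m ∧ ∀ r : ℝ, 0 < r →
        m * ∫ x, d x ^ (-α) * f x * ζ (G.dilation r x) ≤ C * r ^ (2 * q + α - G.homDim) := by
  obtain ⟨ζ, hζ, hζ0, hζ1, hζe, hζz, hHc, C₁, hC₁, hH⟩ := hd.exists_spatial_cutoff hα hpq.lt
  obtain ⟨η, hη, hη0, hη1, hηz, hηi, C₂, hC₂, hη'⟩ := exists_temporal_cutoff hpq.lt
  set H : (Fin n → ℝ) → ℝ := fun x => d x ^ (2 * α) * G.divGrad (fun y => d y ^ (-2 * α)) ζ x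
    with hHdef
  set J := ∫ x in Metric.closedBall 0 1, d x ^ (-α) with hJ
  have hp := hpq.pos
  -- The factor 2 is the length of `[1,3]`, and `J` is the mass of `d^(-α)` on the unit ball.
  refine ⟨ζ, hζ.continuous, hζ0, hζ1, hζe.self_of_nhds, ∫ t, η t, 2 * (C₁ + C₂) ^ q * J, hηi,
    fun r hr => ?_⟩
  have hr2 : 0 < r ^ 2 := by positivity
  -- the compact set carrying the scaled test function
  set I : Set ℝ := Icc ((r ^ 2)⁻¹) (3 * (r ^ 2)⁻¹) with hI
  set B : Set (Fin n → ℝ) := G.dilation r ⁻¹' Metric.closedBall 0 1 with hB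
  have hBc : IsCompact B :=
    (G.dilationHomeomorph hr).isCompact_preimage.mpr (isCompact_closedBall 0 1)
  have hIB : IsCompact (I ×ˢ B) := isCompact_Icc.prod hBc
  have hIpos : ∀ t ∈ I, 0 < t := fun t ht => lt_of_lt_of_le (by positivity) ht.1
  have hIBS : I ×ˢ B ⊆ spaceTime n := fun z hz => ⟨hIpos z.1 hz.1, mem_univ _⟩
  have hscale : ∀ t, t ∉ I → r ^ 2 * t ∉ Icc (1 : ℝ) 3 := by
    intro t ht hmem
    refine ht ⟨?_, ?_⟩
    · rw [inv_le_iff_one_le_mul₀' hr2]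
      exact hmem.1
    · rw [← div_eq_mul_inv, le_div_iff₀' hr2]
      exact hmem.2
  -- the scaled cutoffs
  set e : ℝ → ℝ := fun t => η (r ^ 2 * t) with he
  set b : (Fin n → ℝ) → ℝ := fun x => ζ (G.dilation r x) with hb
  have heS : ContDiff ℝ ∞ e := hη.comp (contDiff_const.mul contDiff_id)
  have hbS : ContDiff ℝ ∞ b := hζ.comp (G.contDiff_dilation r)
  have hez : ∀ t, t ∉ I → e t = 0 := fun t ht => hηz _ (hscale t ht)
  have hbz : ∀ x, x ∉ B → b x = 0 := fun x hx => hζz _ hx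
  have hbe : b =ᶠ[𝓝 0] fun _ => 1 := by
    have : Tendsto (G.dilation r) (𝓝 0) (𝓝 0) := by
      have := (G.contDiff_dilation r).continuous.tendsto 0
      rwa [dilation_origin] at this
    exact this.eventually hζe
  have hder : ∀ t, deriv e t = r ^ 2 * deriv η (r ^ 2 * t) := fun t => deriv_comp_mul_left _ _ _
  have hder_le : ∀ t, |deriv e t| ≤ r ^ 2 * (C₂ * e t ^ (1 / p)) := by
    intro t
    rw [hder, abs_mul, abs_of_pos hr2]
    exact mul_le_mul_of_nonneg_left (hη' _) hr2.le
  have hderz : ∀ t, t ∉ I → deriv e t = 0 := by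
    intro t ht
    have := hder_le t
    rw [hez t ht, Real.zero_rpow (by positivity), MulZeroClass.mul_zero,
      MulZeroClass.mul_zero] at this
    exact abs_nonpos_iff.mp this
  -- The operator scales by `r^(2+2α)`. The factor `r^(2α)` is absorbed by `d(δ_r x)^(2α)`, leaving
  -- `r²`.
  set Hr : (Fin n → ℝ) → ℝ := fun x => r ^ 2 * H (G.dilation r x) with hHr
  have hHrc : Continuous Hr :=
    continuous_const.mul (hHc.comp (G.contDiff_dilation r).continuous)
  have hHr_le : ∀ x, |Hr x| ≤ r ^ 2 * (C₁ * b x ^ (1 / p)) := by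
    intro x
    rw [hHr, abs_mul, abs_of_pos hr2]
    exact mul_le_mul_of_nonneg_left (hH _) hr2.le
  have hHrz : ∀ x, x ∉ B → Hr x = 0 := by
    intro x hx
    have := hHr_le x
    rw [hbz x hx, Real.zero_rpow (by positivity), MulZeroClass.mul_zero,
      MulZeroClass.mul_zero] at this
    exact abs_nonpos_iff.mp this
  have hdiv : ∀ t x, x ≠ 0 → G.divGrad (fun y => d y ^ (-2 * α)) (fun y => e t * b y) x =
      d x ^ (-2 * α) * (e t * Hr x) := by
    intro t x hx
    have hpos := hd.pos x hx
    have h1 : d x ^ (-2 * α) * d x ^ (2 * α) = 1 := by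
      rw [← Real.rpow_add hpos, show -2 * α + 2 * α = 0 by ring, Real.rpow_zero]
    have h2 : r ^ (2 - -2 * α) = r ^ 2 * r ^ (2 * α) := by
      rw [← Real.rpow_natCast, ← Real.rpow_add hr]
      congr 1
      push_cast
      ring
    rw [hd.divGrad_const_mul _ _ hbS hbe, hb, hd.divGrad_comp_dilation _ hζ hζe hr, hHr, hHdef]
    simp only
    rw [hd.rpow_dilation hr, h2]
    linear_combination (-(e t * r ^ 2 * r ^ (2 * α) *
      G.divGrad (fun y => d y ^ (-2 * α)) ζ (G.dilation r x))) * h1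
  have heC : HasCompactSupport e := HasCompactSupport.intro isCompact_Icc hez
  have hψ : IsTestFunction fun t x => e t * b x :=
    isTestFunction_mul heS heC (fun t => hη0 _) hbS (HasCompactSupport.intro hBc hbz)
      fun x => hζ0 _
  have hψz : ∀ z : ℝ × (Fin n → ℝ), z ∉ I ×ˢ B → e z.1 * b z.2 = 0 := by
    intro z hz
    rw [mem_prod, not_and_or] at hz
    rcases hz with hz | hz
    · rw [hez _ hz, MulZeroClass.zero_mul]
    · rw [hbz _ hz, MulZeroClass.mul_zero]
  have hψtz : ∀ z : ℝ × (Fin n → ℝ), z ∉ I ×ˢ B → deriv e z.1 * b z.2 = 0 := by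
    intro z hz
    rw [mem_prod, not_and_or] at hz
    rcases hz with hz | hz
    · rw [hderz _ hz, MulZeroClass.zero_mul]
    · rw [hbz _ hz, MulZeroClass.mul_zero]
  have hψxz : ∀ z : ℝ × (Fin n → ℝ), z ∉ I ×ˢ B → e z.1 * Hr z.2 = 0 := by
    intro z hz
    rw [mem_prod, not_and_or] at hz
    rcases hz with hz | hz
    · rw [hez _ hz, MulZeroClass.zero_mul]
    · rw [hHrz _ hz, MulZeroClass.mul_zero]
  have hderψ : ∀ t x, deriv (fun s => e s * b x) t = deriv e t * b x := fun t x =>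
    deriv_mul_const_field (b x)
  have hec : Continuous fun z : ℝ × (Fin n → ℝ) => e z.1 := heS.continuous.comp continuous_fst
  have hbc : Continuous fun z : ℝ × (Fin n → ℝ) => b z.2 := hbS.continuous.comp continuous_snd
  -- integrability of the terms of the weak equation
  have hfb : Integrable fun x => d x ^ (-α) * f x * b x :=
    hf.mul_bdd (c := 1) hbS.continuous.aestronglyMeasurable (ae_of_all _ fun x => by
      rw [Real.norm_of_nonneg (hζ0 _)]
      exact hζ1 _)
  have hei : Integrable e := heS.continuous.integrable_of_hasCompactSupport heC
  have if1 : Integrable fun z : ℝ × (Fin n → ℝ) => e z.1 * (d z.2 ^ (-α) * f z.2 * b z.2) :=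
    hei.mul_prod hfb
  have iw1 : IntegrableOn (fun z : ℝ × (Fin n → ℝ) =>
      d z.2 ^ (-α * (p + 1)) * w z.1 z.2 ^ p * (e z.1 * b z.2)) (spaceTime n) :=
    integrableOn_mul_of_locallyIntegrableOn hw.locLp hIB hIBS (hec.mul hbc) hψz
  have i1 : IntegrableOn (fun z : ℝ × (Fin n → ℝ) =>
      (d z.2 ^ (-α * (p + 1)) * w z.1 z.2 ^ p + d z.2 ^ (-α) * f z.2) * (e z.1 * b z.2))
      (spaceTime n) := by
    refine (iw1.add if1.integrableOn).congr (ae_of_all _ fun z => ?_)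
    simp only [Pi.add_apply]
    ring
  have i2 : IntegrableOn (fun z : ℝ × (Fin n → ℝ) =>
      d z.2 ^ (-2 * α) * w z.1 z.2 * deriv (fun s => e s * b z.2) z.1) (spaceTime n) := by
    simp_rw [hderψ]
    exact integrableOn_mul_of_locallyIntegrableOn hw.locL1 hIB hIBS
      (((heS.continuous_deriv (by simp)).comp continuous_fst).mul hbc) hψtz
  have e3 : (fun z : ℝ × (Fin n → ℝ) => d z.2 ^ (-2 * α) * w z.1 z.2 * (e z.1 * Hr z.2))
      =ᵐ[volume.restrict (spaceTime n)] fun z => w z.1 z.2 *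
        G.divGrad (fun y => d y ^ (-2 * α)) (fun y => e z.1 * b y) z.2 := by
    filter_upwards [ae_restrict_of_ae ae_snd_ne_zero] with z hz
    rw [hdiv z.1 z.2 hz]
    ring
  have i3 : IntegrableOn (fun z : ℝ × (Fin n → ℝ) => w z.1 z.2 *
      G.divGrad (fun y => d y ^ (-2 * α)) (fun y => e z.1 * b y) z.2) (spaceTime n) :=
    (integrableOn_mul_of_locallyIntegrableOn hw.locL1 hIB hIBS
      (hec.mul (hHrc.comp continuous_snd)) hψxz).congr e3
  have i12 : IntegrableOn (fun z : ℝ × (Fin n → ℝ) =>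
      (d z.2 ^ (-α * (p + 1)) * w z.1 z.2 ^ p + d z.2 ^ (-α) * f z.2) * (e z.1 * b z.2) +
        d z.2 ^ (-2 * α) * w z.1 z.2 * deriv (fun s => e s * b z.2) z.1) (spaceTime n) :=
    i1.add i2
  have key := hw.weak _ hψ i1 i2 i3
  have hinit : ∫ x, d x ^ (-2 * α) * w₀ x * (e 0 * b x) = 0 := by
    have : e 0 = 0 := hez 0 fun h => (hIpos 0 h).ne' rfl
    simp [this]
  rw [hinit, add_zero, ← integral_add i1 i2, ← integral_add i12 i3] at key
  -- the dominating function
  set c := (C₁ + C₂) * r ^ 2 with hc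
  have hc0 : 0 ≤ c := by positivity
  have hBm : MeasurableSet B := hBc.measurableSet
  have hIi : Integrable (I.indicator fun _ => (1 : ℝ)) :=
    (integrable_indicator_iff measurableSet_Icc).mpr
      (integrableOn_const (measure_Icc_lt_top.ne))
  have hBi : Integrable (B.indicator fun x => c ^ q * d x ^ (-α)) :=
    (integrable_indicator_iff hBm).mpr ((hd.integrableOn_dilation_preimage hαQ hr).const_mul _)
  have ih : Integrable fun z : ℝ × (Fin n → ℝ) => I.indicator (fun _ => (1 : ℝ)) z.1 *
      B.indicator (fun x => c ^ q * d x ^ (-α)) z.2 := hIi.mul_prod hBi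
  -- By Young, the dominating function compensates the possibly negative derivative terms using all
  -- of the `w^p` term, so only the `f` term is left. The bracket integrates to zero by the weak
  -- equation.
  have hpoint : ∀ᵐ z ∂(volume.restrict (spaceTime n)),
      e z.1 * (d z.2 ^ (-α) * f z.2 * b z.2) ≤
        ((d z.2 ^ (-α * (p + 1)) * w z.1 z.2 ^ p + d z.2 ^ (-α) * f z.2) * (e z.1 * b z.2) +
          d z.2 ^ (-2 * α) * w z.1 z.2 * deriv (fun s => e s * b z.2) z.1 +
          w z.1 z.2 * G.divGrad (fun y => d y ^ (-2 * α)) (fun y => e z.1 * b y) z.2) +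
        I.indicator (fun _ => (1 : ℝ)) z.1 * B.indicator (fun x => c ^ q * d x ^ (-α)) z.2 := by
    filter_upwards [ae_restrict_of_ae ae_snd_ne_zero, hw.nonneg] with z hz hz0
    have hD := hd.pos z.2 hz
    rw [hdiv z.1 z.2 hz, hderψ]
    by_cases hzK : z ∈ I ×ˢ B
    · rw [indicator_of_mem hzK.1, indicator_of_mem hzK.2, one_mul]
      have he0 : 0 ≤ e z.1 := hη0 _
      have hb0 : 0 ≤ b z.2 := hζ0 _
      have hy := weighted_young hpq α hD hz0 (mul_nonneg he0 hb0) hc0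
      -- The undifferentiated factor lies in `[0,1]`, so it too is bounded by its power `1/p`.
      have hel : e z.1 ≤ e z.1 ^ (1 / p) := Real.self_le_rpow_of_le_one he0 (hη1 _)
        (by rw [div_le_one hp]; exact hpq.lt.le)
      have hbl : b z.2 ≤ b z.2 ^ (1 / p) := Real.self_le_rpow_of_le_one hb0 (hζ1 _)
        (by rw [div_le_one hp]; exact hpq.lt.le)
      have ht : |deriv e z.1 * b z.2| ≤ C₂ * r ^ 2 * (e z.1 * b z.2) ^ (1 / p) := by
        rw [Real.mul_rpow he0 hb0, abs_mul, abs_of_nonneg hb0]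
        calc |deriv e z.1| * b z.2 ≤ (r ^ 2 * (C₂ * e z.1 ^ (1 / p))) * b z.2 ^ (1 / p) :=
              mul_le_mul (hder_le _) hbl hb0 (by positivity)
          _ = _ := by ring
      have hx : |e z.1 * Hr z.2| ≤ C₁ * r ^ 2 * (e z.1 * b z.2) ^ (1 / p) := by
        rw [Real.mul_rpow he0 hb0, abs_mul, abs_of_nonneg he0]
        calc e z.1 * |Hr z.2| ≤ e z.1 ^ (1 / p) * (r ^ 2 * (C₁ * b z.2 ^ (1 / p))) :=
              mul_le_mul hel (hHr_le _) (abs_nonneg _) (by positivity)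
          _ = _ := by ring
      have hsum : -(c * (e z.1 * b z.2) ^ (1 / p)) ≤ deriv e z.1 * b z.2 + e z.1 * Hr z.2 := by
        rw [hc]
        linarith [neg_abs_le (deriv e z.1 * b z.2), neg_abs_le (e z.1 * Hr z.2)]
      have hA : 0 ≤ d z.2 ^ (-2 * α) * w z.1 z.2 := by positivity
      have := mul_le_mul_of_nonneg_left hsum hA
      linarith
    · have h0 := hψz z hzK
      have h1 : w z.1 z.2 * (d z.2 ^ (-2 * α) * (e z.1 * Hr z.2)) = 0 := by
        rw [hψxz z hzK, MulZeroClass.mul_zero, MulZeroClass.mul_zero]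
      have h2 : e z.1 * (d z.2 ^ (-α) * f z.2 * b z.2) = 0 := by
        linear_combination (d z.2 ^ (-α) * f z.2) * h0
      rw [h0, hψtz z hzK, h1, h2]
      have h3 : 0 ≤ I.indicator (fun _ => (1 : ℝ)) z.1 :=
        indicator_nonneg (fun _ _ => zero_le_one) _
      have h4 : 0 ≤ B.indicator (fun x => c ^ q * d x ^ (-α)) z.2 :=
        indicator_nonneg (fun x _ => mul_nonneg (Real.rpow_nonneg hc0 _)
          (Real.rpow_nonneg (hd.nonneg x) _)) _
      have := mul_nonneg h3 h4
      linarith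
  have hmono := integral_mono_ae if1.integrableOn ((i12.add i3).add ih.integrableOn) hpoint
  have hadd : ∫ z in spaceTime n, ((fun z : ℝ × (Fin n → ℝ) =>
      (d z.2 ^ (-α * (p + 1)) * w z.1 z.2 ^ p + d z.2 ^ (-α) * f z.2) * (e z.1 * b z.2) +
          d z.2 ^ (-2 * α) * w z.1 z.2 * deriv (fun s => e s * b z.2) z.1 +
          w z.1 z.2 * G.divGrad (fun y => d y ^ (-2 * α)) (fun y => e z.1 * b y) z.2) z +
        I.indicator (fun _ => (1 : ℝ)) z.1 * B.indicator (fun x => c ^ q * d x ^ (-α)) z.2) =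
      0 + ∫ z in spaceTime n, I.indicator (fun _ => (1 : ℝ)) z.1 *
        B.indicator (fun x => c ^ q * d x ^ (-α)) z.2 := by
    rw [← key]
    exact integral_add (i12.add i3) ih.integrableOn
  have hle := hmono.trans_eq hadd
  rw [zero_add] at hle
  -- evaluation of both sides
  have hprod : ∀ (g : ℝ → ℝ) (h : (Fin n → ℝ) → ℝ), (∀ t, t ∉ I → g t = 0) →
      ∫ z in spaceTime n, g z.1 * h z.2 = (∫ t, g t) * ∫ x, h x := by
    intro g h hg
    have h1 := setIntegral_prod_mul (μ := (volume : Measure ℝ))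
      (ν := (volume : Measure (Fin n → ℝ))) g h (Ioi 0) univ
    have h2 : ∫ t in Ioi 0, g t = ∫ t, g t :=
      setIntegral_eq_integral_of_forall_compl_eq_zero fun t ht => hg t fun hI => ht (hIpos t hI)
    rw [setIntegral_univ, h2] at h1
    exact h1
  rw [hprod e (fun x => d x ^ (-α) * f x * b x) hez,
    hprod (I.indicator fun _ => (1 : ℝ)) (B.indicator fun x => c ^ q * d x ^ (-α))
    (fun t ht => indicator_of_notMem ht _), integral_indicator hBm, integral_const_mul,
    hd.setIntegral_dilation_preimage hr α, integral_indicator measurableSet_Icc] at hle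
  have hI1 : ∫ t in I, (1 : ℝ) = 2 * (r ^ 2)⁻¹ := by
    rw [setIntegral_const, hI, Real.volume_real_Icc_of_le (by
      have : 0 < (r ^ 2)⁻¹ := by positivity
      linarith)]
    simp only [smul_eq_mul]
    ring
  have he1 : ∫ t, e t = (r ^ 2)⁻¹ * ∫ t, η t := by
    rw [he, Measure.integral_comp_mul_left, abs_of_pos (by positivity), smul_eq_mul]
  have hcq : c ^ q * r ^ (α - G.homDim) = (C₁ + C₂) ^ q * r ^ (2 * q + α - G.homDim) := by
    rw [hc, Real.mul_rpow (by positivity) hr2.le, ← Real.rpow_natCast r 2, ← Real.rpow_mul hr.le,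
      _root_.mul_assoc, ← Real.rpow_add hr]
    congr 2
    push_cast
    ring
  rw [hI1, he1, ← hJ] at hle
  -- Both time integrals carry `r^(-2)`, which this cancels.
  have hmul := mul_le_mul_of_nonneg_left hle hr2.le
  calc (∫ t, η t) * ∫ x, d x ^ (-α) * f x * b x
      = r ^ 2 * ((r ^ 2)⁻¹ * (∫ t, η t) * ∫ x, d x ^ (-α) * f x * b x) := by
        field_simp
    _ ≤ _ := hmul
    _ = 2 * (c ^ q * r ^ (α - G.homDim)) * J := by
        field_simp
    _ = _ := by
        rw [hcq]
        ring

/-- Nonexistence for the transformed problem below the critical exponent. -/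
theorem IsGauge.not_isGlobalWeakSolution [NeZero n] (hd : G.IsGauge d) {α p : ℝ} (hα : 0 < α)
    (hαQ : α < G.homDim - 2) (hp_one : 1 < p)
    (hp : p < ((G.homDim : ℝ) - α) / ((G.homDim : ℝ) - 2 - α)) {f w₀ : (Fin n → ℝ) → ℝ}
    (hf : Integrable (fun x => d x ^ (-α) * f x)) (hf_pos : 0 < ∫ x, d x ^ (-α) * f x)
    (w : ℝ → (Fin n → ℝ) → ℝ) : ¬ IsGlobalWeakSolution G d α p f w₀ w := by
  intro hw
  have hpq := Real.HolderConjugate.conjExponent hp_one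
  obtain ⟨ζ, hζ, hζ0, hζ1, hζ2, m, C, hm, hbound⟩ :=
    hd.exists_scaled_bound hα (by linarith) hpq hf hw
  -- With `q = p/(p-1)`, the inequality `q > (Q-α)/2` rearranges to the subcritical bound on `p`.
  have hs : 0 < 2 * p.conjExponent + α - G.homDim := by
    have hp1 : 0 < p - 1 := by linarith
    rw [lt_div_iff₀ (by linarith)] at hp
    have : (G.homDim - α) / 2 < p.conjExponent := by
      rw [Real.conjExponent, lt_div_iff₀ hp1]
      linarith
    linarith
  have hlim : Tendsto (fun r : ℝ => C * r ^ (2 * p.conjExponent + α - G.homDim)) (𝓝[>] 0)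
      (𝓝 (C * 0)) := by
    have h1 : Tendsto (fun r : ℝ => r ^ (2 * p.conjExponent + α - G.homDim)) (𝓝 0) (𝓝 0) := by
      have := (Real.continuousAt_rpow_const 0 _ (Or.inr hs.le)).tendsto
      rwa [Real.zero_rpow hs.ne'] at this
    exact (h1.mono_left nhdsWithin_le_nhds).const_mul C
  have hle := le_of_tendsto_of_tendsto
    ((IsGauge.tendsto_integral_mul_cutoff (G := G) hf hζ hζ0 hζ1 hζ2).const_mul m) hlim
    (eventually_mem_nhdsWithin.mono fun r hr => hbound r hr)
  have := mul_pos hm hf_pos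
  linarith

end StratifiedLieGroup

end

theorem mainTheorem1 {n : ℕ} (G : StratifiedLieGroup n) (hQ : 3 ≤ G.homDim)
    (d : (Fin n → ℝ) → ℝ) (hd : G.IsGauge d)
    (lam : ℝ) (hlam_pos : 0 < lam) (hlam_le : lam ≤ (((G.homDim : ℝ) - 2) / 2) ^ 2)
    (α : ℝ) (hα : α = G.hardyExponent lam)
    (p : ℝ) (hp_one : 1 < p)
    (hp : p < ((G.homDim : ℝ) - α) / ((G.homDim : ℝ) - 2 - α))
    (f u₀ : (Fin n → ℝ) → ℝ)
    (hu₀ : ∀ᵐ x : Fin n → ℝ, 0 ≤ u₀ x)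
    (hf : Integrable (fun x => d x ^ (-α) * f x) volume)
    (hf_pos : 0 < ∫ x, d x ^ (-α) * f x) :
    (¬ ∃ w : ℝ → (Fin n → ℝ) → ℝ,
        IsGlobalWeakSolution G d α p f (fun x => d x ^ α * u₀ x) w) ∧
      (¬ ∃ u : ℝ → (Fin n → ℝ) → ℝ, IsGlobalWeakSolutionHardy G d lam p f u₀ u) := by
  -- In dimension zero the origin would not be a null set; `Q ≥ 3` excludes this.
  have hn : n ≠ 0 := by
    rintro rfl
    simp [StratifiedLieGroup.homDim] at hQ
  have : NeZero n := ⟨hn⟩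
  subst hα
  have key := hd.not_isGlobalWeakSolution
    (w₀ := fun x => d x ^ G.hardyExponent lam * u₀ x)
    (StratifiedLieGroup.hardyExponent_pos hQ hlam_pos)
    (StratifiedLieGroup.hardyExponent_lt hQ lam) hp_one hp hf hf_pos
  exact ⟨fun ⟨w, hw⟩ => key w hw,
    fun ⟨u, hu⟩ => key _ (hd.isGlobalWeakSolution_of_hardy hQ hlam_le hu)⟩
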